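/- Let $S\ge 1$, $\mathcal S=\{1,\dots,S\}$, let $\Delta\subset\mathbb R^{\mathcal S}$ be the probability simplex and $\|\cdot\|$ the $\ell^1$ norm on $\mathbb R^{\mathcal S}$. For $k\ne s$ in $\mathcal S$ let $Q_{ks}:\mathbb R^{\mathcal S}\to\mathbb R$ be locally Lipschitz, with $Q_{ks}\ge 0$ on $[0,\infty)^{\mathcal S}$; put $Q_{ss}=-\sum_{k\ne s}Q_{ks}$ and $Q(\phi)=(Q_{ks}(\phi))_{k,s\in\mathcal S}$. Fix $p\in(0,1]$. For each $N$ let $G^N$ be the Erdős–Rényi random graph on $\{1,\dots,N\}$ with edge probability $p$, that is, $a^N_{ij}=a^N_{ji}$, $a^N_{ii}=0$, and for $i<j$ the indicators $a^N_{ij}$ are i.i.d. with $\mathbb P(a^N_{ij}=1)=p=1-\mathbb P(a^N_{ij}=0)$. Put $\langle d\rangle=(N-1)p$. (i) Exact process. Each vertex carries a state in $\mathcal S$; let $\xi^N_i(t)=(\xi^N_{s,i}(t))_{s\in\mathcal S}$, where $\xi^N_{s,i}(t)$ is the indicator that vertex $i$ is in state $s$ at time $t$. Given $G^N$, the collection $(\xi^N_i(t))_{1\le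 i\le N}$, $t\ge0$, is a right-continuous continuous-time Markov chain in which one vertex changes its state at a time, vertex $i$ jumping from $s$ to $k\neq s$ at rate $Q_{ks}(\phi^N_i(t))$, where $\phi^N_i(t)=\frac1{\langle d\rangle}\sum_{j=1}^N a^N_{ij}\xi^N_j(t)$. The initial configuration is random and may depend on $G^N$. Put $x^N(t)=\frac1N\sum_{i=1}^N\xi^N_i(t)$. (ii) NIMFA. Let $z^N_1,\dots,z^N_N$ solve, for $t\ge 0$, $$\dot z^N_i(t)=Q(\rho^N_i(t))\,z^N_i(t),\qquad \rho^N_i(t)=\frac1{\langle d\rangle}\sum_{j=1}^N a^N_{ij}z^N_j(t),$$ with (possibly random) initial values $z^N_i(0)\in\Delta$. Put $y^N(t)=\frac1N\sum_{i=1}^N z^N_i(t)$. (iii) Mean-field limit. Let $u$ solve $\dot u(t)=Q(u(t))u(t)$ for $t\ge 0$, with deterministic $u(0)\in\Delta$. Then for every $T>0$, as $N\to\infty$: if $x^N(0)\to u(0)$ in probability, then $$\sup_{0\le t\le T}\|x^N(t)-u(t)\|\to0\quad\text{in probability};$$ and if $y^N(0)\to u(0)$ in probability, then $$\sup_{0\le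 t\le T}\|y^N(t)-u(t)\|\to0\quad\text{in probability}.$$ -/

import Mathlib

open MeasureTheory ProbabilityTheory Filter Topology
open scoped ENNReal Matrix

noncomputable section

namespace LocalDensity

/-- Configurations of the exact system: a local state in `Fin S` for each of the `N` vertices. -/
abbrev Config (N S : ℕ) : Type := Fin N → Fin S

/-- The transition rate matrix `Q(φ)` built from the rate functions: for `k ≠ s`, `q k s φ` is
the rate of the transition from `s` to `k`, so the source state is the column index. The diagonal
is fixed by `Q_{ss} = -∑_{k ≠ s} Q_{ks}`; the values `q s s` are never used. -/
def rateMatrix {S : ℕ} (q : Fin S → Fin S → (Fin S → ℝ) → ℝ) (φ : Fin S → ℝ) :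
    Matrix (Fin S) (Fin S) ℝ :=
  Matrix.of fun k s => if k = s then -∑ l ∈ Finset.univ.erase s, q l s φ else q k s φ

open Classical in
/-- The adjacency indicator `a_{ij}` of a simple graph. -/
def edgeIndicator {N : ℕ} (g : SimpleGraph (Fin N)) (i j : Fin N) : ℝ :=
  if g.Adj i j then 1 else 0

/-- The environment `(1 / ⟨d⟩) ∑_j a_{ij} v_j` seen by the vertex `i`, where `⟨d⟩ = (N - 1) p`.
It is `φ_i` for `v = ξ`, and `ρ_i` for `v = z`. -/
def environment {N S : ℕ} (p : ℝ) (g : SimpleGraph (Fin N)) (v : Fin N → Fin S → ℝ)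
    (i : Fin N) : Fin S → ℝ :=
  (1 / (((N : ℝ) - 1) * p)) • ∑ j, edgeIndicator g i j • v j

/-- The average `(1 / N) ∑_i v_i`. -/
def average {N S : ℕ} (v : Fin N → Fin S → ℝ) : Fin S → ℝ :=
  (1 / (N : ℝ)) • ∑ i, v i

/-- The indicator vectors `ξ_i` of a configuration. -/
def indicators {N S : ℕ} (c : Config N S) : Fin N → Fin S → ℝ :=
  fun i => Pi.single (c i) 1

/-- The rate at which the exact system on the graph `g` jumps from `c` to `c'`: one vertex `i`
changes its state from `c i` to some `k ≠ c i`, at rate `q k (c i) φ_i`. -/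
def jumpRate {N S : ℕ} (p : ℝ) (q : Fin S → Fin S → (Fin S → ℝ) → ℝ)
    (g : SimpleGraph (Fin N)) (c c' : Config N S) : ℝ :=
  ∑ i, ∑ k ∈ Finset.univ.erase (c i),
    if c' = Function.update c i k then q k (c i) (environment p g (indicators c) i) else 0

/-- The generator of the exact system on the graph `g`; here the source configuration is the row
index, and the rows sum to zero. -/
def generator {N S : ℕ} (p : ℝ) (q : Fin S → Fin S → (Fin S → ℝ) → ℝ)
    (g : SimpleGraph (Fin N)) : Matrix (Config N S) (Config N S) ℝ :=
  Matrix.of (jumpRate p q g) - Matrix.diagonal fun c => ∑ c', jumpRate p q g c c'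

/-- The σ-algebra generated by the random graph and the process up to time `s`. -/
abbrev past {Ω : Type*} {N S : ℕ} (G : Ω → SimpleGraph (Fin N)) (σ : ℝ → Ω → Config N S) (s : ℝ) :
    MeasurableSpace Ω :=
  MeasurableSpace.comap G inferInstance ⊔
    ⨆ r ∈ Set.Icc (0 : ℝ) s, MeasurableSpace.comap (σ r) inferInstance

/-- `σ` (at times `t ≥ 0`) is the local density-dependent Markov process in the random environment
`G`: given the graph, it is a continuous time Markov chain with right-continuous paths and with
generator `generator p q G`. Its initial configuration may depend on the graph. -/
structure IsExactSystem {Ω : Type*} [MeasurableSpace Ω] {N S : ℕ} (p : ℝ)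
    (q : Fin S → Fin S → (Fin S → ℝ) → ℝ) (P : Measure Ω) (G : Ω → SimpleGraph (Fin N))
    (σ : ℝ → Ω → Config N S) : Prop where
  measurable_graph : Measurable G
  measurable_process : ∀ t, 0 ≤ t → Measurable (σ t)
  right_continuous : ∀ᵐ ω ∂P, ∀ t, 0 ≤ t → ∀ᶠ r in 𝓝[>] t, σ r ω = σ t ω
  markov : ∀ s t, 0 ≤ s → 0 ≤ t → ∀ c : Config N S,
    P[fun ω => if σ (s + t) ω = c then (1 : ℝ) else 0 | past G σ s] =ᵐ[P]
      fun ω => NormedSpace.exp (t • generator p q (G ω)) (σ s ω) c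

/-- `u` solves the homogeneous mean-field equation `u' = Q(u) u` on `[0, ∞)`, from an initial
value in the simplex. -/
def IsMeanFieldSolution {S : ℕ} (q : Fin S → Fin S → (Fin S → ℝ) → ℝ) (u : ℝ → Fin S → ℝ) :
    Prop :=
  u 0 ∈ stdSimplex ℝ (Fin S) ∧
    ∀ t, 0 ≤ t → HasDerivWithinAt u (rateMatrix q (u t) *ᵥ u t) (Set.Ici 0) t

/-- `z` solves the NIMFA system `z_i' = Q(ρ_i) z_i`, `1 ≤ i ≤ N`, on `[0, ∞)` for the graph `g`,
from initial values in the simplex. -/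
def IsNIMFASolution {N S : ℕ} (p : ℝ) (q : Fin S → Fin S → (Fin S → ℝ) → ℝ)
    (g : SimpleGraph (Fin N)) (z : ℝ → Fin N → Fin S → ℝ) : Prop :=
  (∀ i, z 0 i ∈ stdSimplex ℝ (Fin S)) ∧
    ∀ t, 0 ≤ t → ∀ i, HasDerivWithinAt (fun r => z r i)
      (rateMatrix q (environment p g (z t) i) *ᵥ z t i) (Set.Ici 0) t

/-- The `ℓ¹` distance `‖v - w‖₁`, as an extended nonnegative real. -/
def dist₁ {S : ℕ} (v w : Fin S → ℝ) : ℝ≥0∞ :=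
  ENNReal.ofReal (∑ s, |v s - w s|)

/-- Convergence to `0` in probability of nonnegative random variables `X N`, which may live on
different probability spaces. -/
def TendstoZeroInProbability {Ω : ℕ → Type*} [∀ N, MeasurableSpace (Ω N)]
    (P : ∀ N, Measure (Ω N)) (X : ∀ N, Ω N → ℝ≥0∞) : Prop :=
  ∀ ε : ℝ≥0∞, 0 < ε → Tendsto (fun N => P N {ω | ε ≤ X N ω}) atTop (𝓝 0)

end LocalDensity

end

/-! The graph acts on the averages only through the environments of the vertices. A dense random
graph is quasi-random: with high probability, for all bounded vectors `v` at once, neighbourhood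
means of `v` are close to its global mean, in ℓ¹ mean over the vertices (`IsBalanced`). Uniformity
in `v` is essential, since the states are correlated with the graph. It comes from a fourth-moment
computation: if `B` is the centred adjacency matrix, the squared Hilbert–Schmidt norm of `BᵀB` has
expectation at most `2N³`, against the trivial bound `N⁴`, because products over genuine 4-cycles
have mean zero. Markov's inequality and Cauchy–Schwarz, applied twice, then give
`tendsto_measure_not_isBalanced`.

On a balanced graph the averaged drift differs by at most `K S η` from the mean-field drift at the
average (`IsBalanced.norm_average_drift_sub_le`), so the average almost solves the mean-field
equation. Invariance of the simplex keeps all environments in the ball of radius `2 / p`, where the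
locally Lipschitz rates have uniform constants. For NIMFA, Grönwall's inequality concludes.

In the exact system, jumps of size `1 / N` occur at total rate `O(N)`, so the average fluctuates
with variance `O(1 / N)` per unit time. The process is sampled on a time grid: Doob's inequality
controls the sum of the innovations (`measure_exists_le_abs_sum_innovation`), and a discrete
Grönwall inequality compares the samples with `u` (`IsExactSystem.measure_grid_le`). With `N` fixed,
the mesh tends to zero through dyadic grids, and right-continuity recovers the supremum over all
times; only then does `N` tend to infinity. -/

namespace LocalDensity

/-! ### Bounds on the rates -/

/-- On the sup-norm ball of radius `R`, the rates are bounded by `K`, and the vector `Q(φ) v` is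
bounded by `K ‖v‖` and Lipschitz in `φ` with constant `K ‖v‖`. -/
structure RateBound {S : ℕ} (q : Fin S → Fin S → (Fin S → ℝ) → ℝ) (R K : ℝ) : Prop where
  nonneg : 0 ≤ K
  rate_le : ∀ k s, k ≠ s → ∀ φ, ‖φ‖ ≤ R → |q k s φ| ≤ K
  norm_mulVec_le : ∀ φ v, ‖φ‖ ≤ R → ‖rateMatrix q φ *ᵥ v‖ ≤ K * ‖v‖
  norm_mulVec_sub_le : ∀ φ ψ v, ‖φ‖ ≤ R → ‖ψ‖ ≤ R →
    ‖rateMatrix q φ *ᵥ v - rateMatrix q ψ *ᵥ v‖ ≤ K * ‖φ - ψ‖ * ‖v‖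

theorem norm_mulVec_le_of_abs_le {S : ℕ} {A : Matrix (Fin S) (Fin S) ℝ} {c : ℝ}
    (hA : ∀ k s, |A k s| ≤ c) (v : Fin S → ℝ) (hc : 0 ≤ c) : ‖A *ᵥ v‖ ≤ S * c * ‖v‖ := by
  refine (pi_norm_le_iff_of_nonneg (by positivity)).2 fun k => ?_
  calc ‖(A *ᵥ v) k‖ = |∑ s, A k s * v s| := rfl
    _ ≤ ∑ s, |A k s * v s| := Finset.abs_sum_le_sum_abs _ _
    _ ≤ ∑ _s : Fin S, c * ‖v‖ := by
        refine Finset.sum_le_sum fun s _ => ?_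
        rw [abs_mul]
        exact mul_le_mul (hA k s) (norm_le_pi_norm v s) (abs_nonneg _) hc
    _ = S * c * ‖v‖ := by simp [mul_assoc]

theorem exists_rateBound {S : ℕ} {q : Fin S → Fin S → (Fin S → ℝ) → ℝ}
    (hq_lip : ∀ k s, k ≠ s → LocallyLipschitz (q k s)) {R : ℝ} :
    ∃ K, RateBound q R K := by
  have hcomp : IsCompact (Metric.closedBall (0 : Fin S → ℝ) R) := isCompact_closedBall _ _
  have hb : ∀ k s, ∃ C : ℝ, 0 ≤ C ∧ (k ≠ s → (∀ φ, ‖φ‖ ≤ R → |q k s φ| ≤ C) ∧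
      ∀ φ ψ, ‖φ‖ ≤ R → ‖ψ‖ ≤ R → |q k s φ - q k s ψ| ≤ C * ‖φ - ψ‖) := by
    intro k s
    by_cases h : k = s
    · exact ⟨0, le_rfl, fun h' => absurd h h'⟩
    obtain ⟨L, hL⟩ := LocallyLipschitzOn.exists_lipschitzOnWith_of_compact hcomp
      (hq_lip k s h).locallyLipschitzOn
    obtain ⟨C, hC⟩ := hcomp.exists_bound_of_continuousOn (hq_lip k s h).continuous.continuousOn
    refine ⟨max (L : ℝ) C, le_max_of_le_left L.2, fun _ => ⟨fun φ hφ => ?_, fun φ ψ hφ hψ => ?_⟩⟩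
    · exact (hC φ (by simpa using hφ)).trans (le_max_right _ _)
    · have := hL.dist_le_mul φ (by simpa using hφ) ψ (by simpa using hψ)
      rw [Real.dist_eq, dist_eq_norm] at this
      exact this.trans (by gcongr; exact le_max_left _ _)
  choose C hC0 hC using hb
  set D : ℝ := ∑ k, ∑ s, C k s
  have hD0 : 0 ≤ D := Finset.sum_nonneg fun k _ => Finset.sum_nonneg fun s _ => hC0 k s
  have hCD : ∀ k s, C k s ≤ D := fun k s =>
    (Finset.single_le_sum (f := fun s => C k s) (fun s _ => hC0 k s) (Finset.mem_univ s)).trans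
      (Finset.single_le_sum (f := fun k => ∑ s, C k s)
        (fun k _ => Finset.sum_nonneg fun s _ => hC0 k s) (Finset.mem_univ k))
  have hsumD : ∀ s, ∑ l ∈ Finset.univ.erase s, C l s ≤ D := fun s => by
    refine (Finset.sum_le_sum_of_subset_of_nonneg (Finset.subset_univ _)
      fun k _ _ => hC0 k s).trans ?_
    exact Finset.sum_le_sum fun k _ =>
      Finset.single_le_sum (f := fun s => C k s) (fun s _ => hC0 k s) (Finset.mem_univ s)
  have hM : ∀ φ, ‖φ‖ ≤ R → ∀ k s, |rateMatrix q φ k s| ≤ D := by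
    intro φ hφ k s
    simp only [rateMatrix, Matrix.of_apply]
    split_ifs with h
    · rw [abs_neg]
      refine (Finset.abs_sum_le_sum_abs _ _).trans (le_trans ?_ (hsumD s))
      exact Finset.sum_le_sum fun l hl => (hC l s (Finset.ne_of_mem_erase hl)).1 φ hφ
    · exact ((hC k s h).1 φ hφ).trans (hCD k s)
  have hMsub : ∀ φ ψ, ‖φ‖ ≤ R → ‖ψ‖ ≤ R → ∀ k s,
      |(rateMatrix q φ - rateMatrix q ψ) k s| ≤ D * ‖φ - ψ‖ := by
    intro φ ψ hφ hψ k s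
    simp only [rateMatrix, Matrix.of_apply, Matrix.sub_apply]
    split_ifs with h
    · rw [neg_sub_neg, ← Finset.sum_sub_distrib]
      refine (Finset.abs_sum_le_sum_abs _ _).trans ?_
      refine le_trans ?_ (mul_le_mul_of_nonneg_right (hsumD s) (norm_nonneg _))
      rw [Finset.sum_mul]
      refine Finset.sum_le_sum fun l hl => ?_
      rw [abs_sub_comm]
      exact (hC l s (Finset.ne_of_mem_erase hl)).2 φ ψ hφ hψ
    · exact ((hC k s h).2 φ ψ hφ hψ).trans (by gcongr; exact hCD k s)
  -- The factor `S + 1` rather than `S` makes one constant serve for the entries and for the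
  -- matrix-vector bounds, even when `S = 0`.
  have hS : D ≤ (S + 1) * D := by nlinarith [Nat.cast_nonneg (α := ℝ) S]
  refine ⟨(S + 1) * D, by positivity, fun k s h φ hφ => ?_, fun φ v hφ => ?_,
    fun φ ψ v hφ hψ => ?_⟩
  · exact (((hC k s h).1 φ hφ).trans (hCD k s)).trans hS
  · refine (norm_mulVec_le_of_abs_le (hM φ hφ) v hD0).trans ?_
    gcongr
    simp
  · rw [← Matrix.sub_mulVec]
    refine (norm_mulVec_le_of_abs_le (hMsub φ ψ hφ hψ) v (by positivity)).trans ?_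
    rw [← mul_assoc]
    gcongr
    simp

theorem RateBound.norm_mulVec_sub_mulVec_le {S : ℕ} {q : Fin S → Fin S → (Fin S → ℝ) → ℝ}
    {R K : ℝ} (hK : RateBound q R K) {φ ψ : Fin S → ℝ} (v w : Fin S → ℝ)
    (hφ : ‖φ‖ ≤ R) (hψ : ‖ψ‖ ≤ R) :
    ‖rateMatrix q φ *ᵥ v - rateMatrix q ψ *ᵥ w‖ ≤ K * ‖φ - ψ‖ * ‖v‖ + K * ‖v - w‖ := by
  have h : rateMatrix q φ *ᵥ v - rateMatrix q ψ *ᵥ w =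
      (rateMatrix q φ *ᵥ v - rateMatrix q ψ *ᵥ v) + rateMatrix q ψ *ᵥ (v - w) := by
    rw [Matrix.mulVec_sub]; abel
  rw [h]
  exact (norm_add_le _ _).trans
    (add_le_add (hK.norm_mulVec_sub_le φ ψ v hφ hψ) (hK.norm_mulVec_le ψ _ hψ))

theorem norm_le_one_of_mem_stdSimplex {S : ℕ} {v : Fin S → ℝ} (hv : v ∈ stdSimplex ℝ (Fin S)) :
    ‖v‖ ≤ 1 := by
  refine (pi_norm_le_iff_of_nonneg zero_le_one).2 fun s => ?_
  rw [Real.norm_eq_abs, abs_of_nonneg (hv.1 s), ← hv.2]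
  exact Finset.single_le_sum (fun s _ => hv.1 s) (Finset.mem_univ s)

/-! ### Invariance of the simplex -/

theorem sum_rateMatrix_mulVec {S : ℕ} (q : Fin S → Fin S → (Fin S → ℝ) → ℝ) (φ v : Fin S → ℝ) :
    ∑ k, (rateMatrix q φ *ᵥ v) k = 0 := by
  simp only [Matrix.mulVec, dotProduct]
  rw [Finset.sum_comm]
  refine Finset.sum_eq_zero fun s _ => ?_
  rw [← Finset.sum_mul, ← Finset.add_sum_erase _ _ (Finset.mem_univ s)]
  have : ∑ k ∈ Finset.univ.erase s, rateMatrix q φ k s = ∑ k ∈ Finset.univ.erase s, q k s φ :=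
    Finset.sum_congr rfl fun k hk => by
      simp [rateMatrix, Finset.ne_of_mem_erase hk]
  rw [this]
  simp [rateMatrix]

/-- The squared negative part is differentiable even at `0`, which makes it usable as a Lyapunov
function for nonnegativity. -/
theorem hasDerivAt_min_zero_sq (x : ℝ) :
    HasDerivAt (fun x : ℝ => (min x 0) ^ 2) (2 * min x 0) x := by
  rcases lt_trichotomy x 0 with h | h | h
  · have : (fun x : ℝ => (min x 0) ^ 2) =ᶠ[𝓝 x] fun x => x ^ 2 := by
      filter_upwards [eventually_lt_nhds h] with y hy
      rw [min_eq_left hy.le]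
    rw [min_eq_left h.le]
    simpa using (hasDerivAt_pow 2 x).congr_of_eventuallyEq this
  · subst h
    rw [hasDerivAt_iff_isLittleO]
    simp only [min_self, mul_zero, smul_zero, sub_zero, ne_eq, OfNat.ofNat_ne_zero,
      not_false_eq_true, zero_pow]
    refine Asymptotics.IsBigO.trans_isLittleO (g := fun y : ℝ => y ^ 2) ?_ ?_
    · refine Asymptotics.IsBigO.of_bound 1 (Eventually.of_forall fun y => ?_)
      rw [one_mul, Real.norm_eq_abs, Real.norm_eq_abs, abs_pow, abs_pow]
      gcongr 1
      rcases le_total y 0 with hy | hy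
      · rw [min_eq_left hy]
      · rw [min_eq_right hy]; simp
    · simpa using Asymptotics.isLittleO_pow_id (𝕜 := ℝ) (n := 2) (by norm_num)
  · have : (fun x : ℝ => (min x 0) ^ 2) =ᶠ[𝓝 x] fun _ => 0 := by
      filter_upwards [eventually_gt_nhds h] with y hy
      rw [min_eq_right hy.le]; simp
    rw [min_eq_right h.le, mul_zero]
    exact (hasDerivAt_const x (0 : ℝ)).congr_of_eventuallyEq this

/-- The simplex is invariant under the interacting system `z_i' = Q(∑_j w_{ij} z_j) z_i` with
nonnegative weights `w`. -/
theorem mem_stdSimplex_of_hasDerivWithinAt {S : ℕ} {ι : Type*} [Fintype ι]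
    {q : Fin S → Fin S → (Fin S → ℝ) → ℝ}
    (hq_lip : ∀ k s, k ≠ s → LocallyLipschitz (q k s))
    (hq_nonneg : ∀ k s, k ≠ s → ∀ φ : Fin S → ℝ, (∀ l, 0 ≤ φ l) → 0 ≤ q k s φ)
    {w : ι → ι → ℝ} (hw : ∀ i j, 0 ≤ w i j) {z : ℝ → ι → Fin S → ℝ}
    (hz0 : ∀ i, z 0 i ∈ stdSimplex ℝ (Fin S))
    (hz : ∀ t, 0 ≤ t → ∀ i, HasDerivWithinAt (fun r => z r i)
      (rateMatrix q (∑ j, w i j • z t j) *ᵥ z t i) (Set.Ici 0) t)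
    {t : ℝ} (ht : 0 ≤ t) (i : ι) : z t i ∈ stdSimplex ℝ (Fin S) := by
  have hzc : ∀ i, ContinuousOn (fun r => z r i) (Set.Icc 0 t) := fun i r hr =>
    ((hz r hr.1 i).continuousWithinAt).mono Set.Icc_subset_Ici_self
  have hzs : ∀ r, 0 ≤ r → ∀ i s, HasDerivWithinAt (fun r => z r i s)
      ((rateMatrix q (∑ j, w i j • z r j) *ᵥ z r i) s) (Set.Ici r) r := fun r hr i s =>
    ((hasDerivWithinAt_pi.1 (hz r hr i)) s).mono (Set.Ici_subset_Ici.2 hr)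
  refine ⟨?_, ?_⟩
  · -- nonnegativity
    obtain ⟨B, hB⟩ : ∃ B : ℝ, ∀ r ∈ Set.Icc 0 t, ‖z r‖ ≤ B :=
      isCompact_Icc.exists_bound_of_continuousOn (continuousOn_pi.2 hzc)
    have hB0 : 0 ≤ B := (norm_nonneg _).trans (hB 0 ⟨le_rfl, ht⟩)
    set W : ℝ := ∑ i, ∑ j, w i j
    have hW0 : 0 ≤ W := Finset.sum_nonneg fun i _ => Finset.sum_nonneg fun j _ => hw i j
    have hWi : ∀ i (v : ι → Fin S → ℝ), ‖∑ j, w i j • v j‖ ≤ W * ‖v‖ := by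
      intro i v
      calc ‖∑ j, w i j • v j‖ ≤ ∑ j, ‖w i j • v j‖ := norm_sum_le _ _
        _ ≤ ∑ j, w i j * ‖v‖ := by
            refine Finset.sum_le_sum fun j _ => ?_
            rw [norm_smul, Real.norm_of_nonneg (hw i j)]
            exact mul_le_mul_of_nonneg_left (norm_le_pi_norm v j) (hw i j)
        _ = (∑ j, w i j) * ‖v‖ := (Finset.sum_mul ..).symm
        _ ≤ W * ‖v‖ := by
            gcongr
            exact Finset.single_le_sum (f := fun i => ∑ j, w i j)
              (fun i _ => Finset.sum_nonneg fun j _ => hw i j) (Finset.mem_univ i)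
    obtain ⟨K, hK⟩ := exists_rateBound hq_lip (R := W * B)
    have hK0 := hK.nonneg
    -- `D` measures the distance to the nonnegative orthant. It vanishes at time `0`, and a bound
    -- `D' ≤ const * D` forces it to stay zero.
    set D : ℝ → ℝ := fun r => ∑ i, ∑ s, (min (z r i s) 0) ^ 2 with hD
    set D' : ℝ → ℝ := fun r => ∑ i, ∑ s, 2 * min (z r i s) 0 *
      (rateMatrix q (∑ j, w i j • z r j) *ᵥ z r i) s
    have hDderiv : ∀ r, 0 ≤ r → HasDerivWithinAt D (D' r) (Set.Ici r) r := by
      intro r hr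
      refine HasDerivWithinAt.fun_sum fun i _ => HasDerivWithinAt.fun_sum fun s _ => ?_
      exact (hasDerivAt_min_zero_sq (z r i s)).comp_hasDerivWithinAt r (hzs r hr i s)
    have hDcont : ContinuousOn D (Set.Icc 0 t) := by
      refine continuousOn_finsetSum _ fun i _ => continuousOn_finsetSum _ fun s _ => ?_
      exact ((((continuous_apply s).comp_continuousOn (hzc i)).inf continuousOn_const).pow 2)
    have hbound : ∀ r ∈ Set.Ico 0 t,
        D' r ≤ (∑ _i : ι, ∑ _s : Fin S, 2 * (K * W * B + K)) * D r + 0 := by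
      intro r hr
      have hzB := hB r ⟨hr.1, hr.2.le⟩
      set m : ι → Fin S → ℝ := fun i s => min (z r i s) 0
      -- The sign of the rates is known only at nonnegative arguments, so the field at `z r` is
      -- compared with the field at its positive part, at distance `‖m‖`.
      set zp : ι → Fin S → ℝ := fun i s => max (z r i s) 0
      have hzm : z r - zp = m := by
        ext i s
        simp only [Pi.sub_apply, m, zp]
        rcases le_total (z r i s) 0 with h | h <;> simp [h]
      have hzpB : ‖zp‖ ≤ B := by
        refine (pi_norm_le_iff_of_nonneg hB0).2 fun i => (pi_norm_le_iff_of_nonneg hB0).2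
          fun s => ?_
        have h1 : |z r i s| ≤ B := ((norm_le_pi_norm (z r i) s).trans (norm_le_pi_norm _ i)).trans hzB
        rw [Real.norm_eq_abs, abs_of_nonneg (le_max_right _ _)]
        exact max_le ((le_abs_self _).trans h1) hB0
      have hmabs : ∀ i s, |m i s| ≤ ‖m‖ := fun i s =>
        (norm_le_pi_norm (m i) s).trans (norm_le_pi_norm m i)
      have hmD : ‖m‖ ^ 2 ≤ D r := by
        have hDr : 0 ≤ D r := Finset.sum_nonneg fun i _ => Finset.sum_nonneg fun s _ => sq_nonneg _
        rw [← Real.sqrt_le_sqrt_iff hDr, Real.sqrt_sq (norm_nonneg _)]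
        refine (pi_norm_le_iff_of_nonneg (Real.sqrt_nonneg _)).2 fun i =>
          (pi_norm_le_iff_of_nonneg (Real.sqrt_nonneg _)).2 fun s => Real.abs_le_sqrt ?_
        exact (Finset.single_le_sum (f := fun s => m i s ^ 2) (fun s _ => sq_nonneg _)
          (Finset.mem_univ s)).trans (Finset.single_le_sum (f := fun i => ∑ s, m i s ^ 2)
          (fun i _ => Finset.sum_nonneg fun s _ => sq_nonneg _) (Finset.mem_univ i))
      rw [add_zero, Finset.sum_mul]
      refine Finset.sum_le_sum fun i _ => ?_
      rw [Finset.sum_mul]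
      refine Finset.sum_le_sum fun s _ => ?_
      change 2 * m i s * _ ≤ _
      suffices h : m i s * (rateMatrix q (∑ j, w i j • z r j) *ᵥ z r i) s ≤
          (K * W * B + K) * ‖m‖ ^ 2 by
        have := mul_le_mul_of_nonneg_left hmD (show 0 ≤ K * W * B + K by positivity)
        linarith
      rcases le_or_gt 0 (z r i s) with h | h
      · have : m i s = 0 := min_eq_right h
        rw [this, zero_mul]
        positivity
      · have hmneg : m i s ≤ 0 := min_le_right _ _
        -- Where a coordinate of `z` is negative, that of `zp` is zero, which kills the only
        -- negative entry of the row: the field at `zp` points inwards.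
        have hpos : 0 ≤ (rateMatrix q (∑ j, w i j • zp j) *ᵥ zp i) s := by
          simp only [Matrix.mulVec, dotProduct]
          refine Finset.sum_nonneg fun k _ => ?_
          by_cases hk : s = k
          · subst hk
            have : zp i s = 0 := max_eq_right h.le
            simp [this]
          · refine mul_nonneg ?_ (le_max_right _ _)
            simp only [rateMatrix, Matrix.of_apply, if_neg hk]
            refine hq_nonneg s k hk _ fun l => ?_
            simp only [Finset.sum_apply, Pi.smul_apply, smul_eq_mul]
            exact Finset.sum_nonneg fun j _ => mul_nonneg (hw i j) (le_max_right _ _)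
        have hdiff := hK.norm_mulVec_sub_mulVec_le (φ := ∑ j, w i j • z r j)
          (ψ := ∑ j, w i j • zp j) (z r i) (zp i)
          ((hWi i _).trans (by gcongr)) ((hWi i _).trans (by gcongr))
        have h1 : ‖∑ j, w i j • z r j - ∑ j, w i j • zp j‖ ≤ W * ‖m‖ := by
          rw [← Finset.sum_sub_distrib, ← hzm]
          simpa only [smul_sub, Pi.sub_apply] using hWi i (z r - zp)
        have h2 : ‖z r i - zp i‖ ≤ ‖m‖ := by
          rw [← hzm]; exact norm_le_pi_norm (z r - zp) i
        have h3 : ‖z r i‖ ≤ B := (norm_le_pi_norm _ i).trans hzB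
        have h4 : |(rateMatrix q (∑ j, w i j • z r j) *ᵥ z r i) s -
            (rateMatrix q (∑ j, w i j • zp j) *ᵥ zp i) s| ≤ (K * W * B + K) * ‖m‖ := by
          refine (norm_le_pi_norm (_ - _ : Fin S → ℝ) s).trans (hdiff.trans ?_)
          calc _ ≤ K * (W * ‖m‖) * B + K * ‖m‖ := by gcongr
            _ = _ := by ring
        have h5 := (abs_le.1 h4).1
        have h6 : -m i s ≤ ‖m‖ := (neg_le_abs _).trans (hmabs i s)
        have h7 : 0 ≤ (K * W * B + K) * ‖m‖ := by positivity
        nlinarith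
    have hD0 : D 0 ≤ 0 := by
      refine (Finset.sum_eq_zero fun i _ => Finset.sum_eq_zero fun s _ => ?_).le
      rw [min_eq_right ((hz0 i).1 s)]; simp
    have hfin := le_gronwallBound_of_liminf_deriv_right_le hDcont
      (fun r hr _ hlt => (hDderiv r hr.1).liminf_right_slope_le hlt) hD0 hbound t ⟨ht, le_rfl⟩
    rw [gronwallBound_ε0, zero_mul] at hfin
    intro s
    have h1 : (min (z t i s) 0) ^ 2 ≤ 0 := le_trans
      ((Finset.single_le_sum (f := fun s => (min (z t i s) 0) ^ 2) (fun s _ => sq_nonneg _)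
          (Finset.mem_univ s)).trans (Finset.single_le_sum (f := fun i => ∑ s, (min (z t i s) 0) ^ 2)
          (fun i _ => Finset.sum_nonneg fun s _ => sq_nonneg _) (Finset.mem_univ i))) hfin
    have h2 : min (z t i s) 0 = 0 := by
      have := le_antisymm h1 (sq_nonneg _)
      exact pow_eq_zero_iff (two_ne_zero) |>.1 this
    exact min_eq_right_iff.1 h2
  · -- conservation of mass
    have hc : ContinuousOn (fun r => ∑ s, z r i s) (Set.Icc 0 t) :=
      continuousOn_finsetSum _ fun s _ => (continuous_apply s).comp_continuousOn (hzc i)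
    have hd : ∀ r ∈ Set.Ico 0 t, HasDerivWithinAt (fun r => ∑ s, z r i s) 0 (Set.Ici r) r := by
      intro r hr
      have := HasDerivWithinAt.fun_sum (u := Finset.univ) fun s _ => hzs r hr.1 i s
      rwa [sum_rateMatrix_mulVec] at this
    exact (constant_of_has_deriv_right_zero hc hd t ⟨ht, le_rfl⟩).trans (hz0 i).2

/-! ### Uniform density of the binomial random graph -/

/-- On a finite vertex set there are finitely many graphs, so this makes every function of the graph
measurable, and integrable for a finite measure. -/
instance measurableSingletonClass_simpleGraph {V : Type*} [Countable V] :
    MeasurableSingletonClass (SimpleGraph V) where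
  measurableSet_singleton g := by
    have : ({g} : Set (SimpleGraph V)) = SimpleGraph.Adj ⁻¹' {g.Adj} := by
      ext h
      simp only [Set.mem_singleton_iff, Set.mem_preimage]
      exact SimpleGraph.ext_iff
    rw [this]
    exact SimpleGraph.measurable_adj (measurableSet_singleton _)

/-- The centred adjacency matrix, with vanishing diagonal. -/
noncomputable def centeredAdj {N : ℕ} (p : ℝ) (g : SimpleGraph (Fin N)) (i j : Fin N) : ℝ :=
  if i = j then 0 else edgeIndicator g i j - p

theorem abs_centeredAdj_le_one {N : ℕ} {p : ℝ} (hp0 : 0 ≤ p) (hp1 : p ≤ 1)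
    (g : SimpleGraph (Fin N)) (i j : Fin N) : |centeredAdj p g i j| ≤ 1 := by
  unfold centeredAdj edgeIndicator
  rw [abs_le]
  split_ifs <;> constructor <;> linarith

open Classical in
/-- The centred indicator of an edge, as a function of the family of all edge indicators. -/
noncomputable def centeredEdge {V : Type*} (p : ℝ) (e : Sym2 V) (ω : Sym2 V → Prop) : ℝ :=
  (if ω e then 1 else 0) - p

/-- Passing to the product space makes the independence of the edges available. Coordinates on the
diagonal of `Sym2` are almost surely `False`. -/
theorem integral_binomialRandom {N : ℕ} (p : unitInterval) (f : SimpleGraph (Fin N) → ℝ) :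
    ∫ g, f g ∂SimpleGraph.binomialRandom (Fin N) p =
      ∫ ω : Sym2 (Fin N) → Prop, f (SimpleGraph.fromEdgeSet {e | ω e})
        ∂(Measure.infinitePi fun e : Sym2 (Fin N) =>
          unitInterval.toNNReal p • Measure.dirac (e ∈ (Sym2.diagSetᶜ : Set (Sym2 (Fin N)))) +
            unitInterval.toNNReal (unitInterval.symm p) • Measure.dirac False) := by
  have hset : Measurable fun ω : Sym2 (Fin N) → Prop => {e | ω e} :=
    measurable_set_iff.2 fun e => measurable_pi_apply e
  rw [SimpleGraph.binomialRandom_eq_map, setBernoulli_eq_map,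
    Measure.map_map SimpleGraph.measurable_fromEdgeSet hset,
    integral_map (SimpleGraph.measurable_fromEdgeSet.comp hset).aemeasurable
      Measurable.of_discrete.aestronglyMeasurable]
  rfl

/-- By independence the factor of `e` splits off, and its mean is `p (1 - p) + (1 - p) (-p) = 0`. A
diagonal `e` would instead have mean `-p`. -/
theorem integral_centeredEdge_mul_prod_eq_zero {V : Type*} [Countable V] (p : unitInterval)
    {e : Sym2 V} (he : ¬ e.IsDiag) {T : Finset (Sym2 V)} (heT : e ∉ T) :
    ∫ ω : Sym2 V → Prop, (∏ e' ∈ T, centeredEdge p e' ω) * centeredEdge p e ω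
        ∂(Measure.infinitePi fun e : Sym2 V =>
          unitInterval.toNNReal p • Measure.dirac (e ∈ (Sym2.diagSetᶜ : Set (Sym2 V))) +
            unitInterval.toNNReal (unitInterval.symm p) • Measure.dirac False) = 0 := by
  classical
  set ν : Sym2 V → Measure Prop := fun e : Sym2 V =>
    unitInterval.toNNReal p • Measure.dirac (e ∈ (Sym2.diagSetᶜ : Set (Sym2 V))) +
      unitInterval.toNNReal (unitInterval.symm p) • Measure.dirac False
  have hind : iIndepFun (fun (e : Sym2 V) ω => centeredEdge (V := V) p e ω)
      (Measure.infinitePi ν) :=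
    iIndepFun_infinitePi (P := ν) (X := fun _ b => (if b then (1 : ℝ) else 0) - (p : ℝ))
      fun _ => Measurable.of_discrete
  have hmeas : ∀ e : Sym2 V, Measurable (centeredEdge (V := V) p e) := fun e =>
    (Measurable.of_discrete (f := fun b : Prop => (if b then (1 : ℝ) else 0) - (p : ℝ))).comp
      (measurable_pi_apply e)
  have h := (hind.indepFun_finsetProd_of_notMem hmeas heT).integral_mul_eq_mul_integral
    (by
      rw [Finset.prod_fn]
      exact (Finset.measurable_prod T fun e _ => hmeas e).aestronglyMeasurable)
    (hmeas e).aestronglyMeasurable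
  have h0 : ∫ ω, centeredEdge p e ω ∂(Measure.infinitePi ν) = 0 := by
    have h1 : ∫ ω, centeredEdge p e ω ∂(Measure.infinitePi ν) =
        ∫ b, ((if b then (1 : ℝ) else 0) - (p : ℝ)) ∂(ν e) := by
      rw [← Measure.infinitePi_map_eval ν e, integral_map (measurable_pi_apply e).aemeasurable
        Measurable.of_discrete.aestronglyMeasurable]
      rfl
    have he' : e ∈ (Sym2.diagSetᶜ : Set (Sym2 V)) := by simpa using he
    rw [h1, integral_add_measure .of_finite .of_finite, integral_smul_nnreal_measure,
      integral_smul_nnreal_measure, integral_dirac, integral_dirac, if_pos he', if_neg id]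
    simp only [NNReal.smul_def, unitInterval.coe_toNNReal, unitInterval.coe_symm_eq, smul_eq_mul]
    ring
  rw [h0, mul_zero] at h
  rw [← h]
  refine integral_congr_ae (Eventually.of_forall fun ω => ?_)
  simp [Finset.prod_apply]

theorem centeredAdj_fromEdgeSet {N : ℕ} (p : ℝ) {i j : Fin N} (hij : i ≠ j)
    (ω : Sym2 (Fin N) → Prop) :
    centeredAdj p (SimpleGraph.fromEdgeSet {e | ω e}) i j = centeredEdge p s(i, j) ω := by
  have : (SimpleGraph.fromEdgeSet {e | ω e}).Adj i j ↔ ω s(i, j) := by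
    rw [SimpleGraph.fromEdgeSet_adj]
    exact and_iff_left hij
  simp only [centeredAdj, edgeIndicator, centeredEdge, if_neg hij]
  by_cases h : ω s(i, j)
  · rw [if_pos h, if_pos (this.2 h)]
  · rw [if_neg h, if_neg (mt this.1 h)]

/-- Either a factor lies on the vanishing diagonal, or the four vertices are distinct and the
factors belong to the four distinct edges of a 4-cycle, of which one can be integrated out. -/
theorem integral_centeredAdj_rectangle {N : ℕ} (p : unitInterval) {i i' j k : Fin N}
    (hi : i ≠ i') (hj : j ≠ k) :
    ∫ g, (centeredAdj p g i j * centeredAdj p g i k) *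
      (centeredAdj p g i' j * centeredAdj p g i' k)
      ∂SimpleGraph.binomialRandom (Fin N) p = 0 := by
  by_cases h : i = j ∨ i = k ∨ i' = j ∨ i' = k
  · have : ∀ g : SimpleGraph (Fin N), (centeredAdj p g i j * centeredAdj p g i k) *
        (centeredAdj p g i' j * centeredAdj p g i' k) = 0 := by
      intro g
      rcases h with h | h | h | h <;> simp [centeredAdj, h]
    simp [this]
  push Not at h
  obtain ⟨h1, h2, h3, h4⟩ := h
  rw [integral_binomialRandom, ← integral_centeredEdge_mul_prod_eq_zero p (e := s(i, j))
    (T := {s(i, k), s(i', j), s(i', k)}) (by simpa using h1) (by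
      simp only [Finset.mem_insert, Finset.mem_singleton, Sym2.eq_iff]
      grind)]
  refine integral_congr_ae (Eventually.of_forall fun ω => ?_)
  simp only
  rw [centeredAdj_fromEdgeSet _ h1, centeredAdj_fromEdgeSet _ h2, centeredAdj_fromEdgeSet _ h3,
    centeredAdj_fromEdgeSet _ h4, Finset.prod_insert, Finset.prod_insert, Finset.prod_singleton]
  · ring
  · simp only [Finset.mem_singleton, Sym2.eq_iff]; grind
  · simp only [Finset.mem_insert, Finset.mem_singleton, Sym2.eq_iff]; grind

/-- The sum of the squared entries of the square of the centred adjacency matrix. -/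
noncomputable def squareEnergy {N : ℕ} (p : ℝ) (g : SimpleGraph (Fin N)) : ℝ :=
  ∑ j, ∑ k, (∑ i, centeredAdj p g i j * centeredAdj p g i k) ^ 2

/-- Expanding the square for `j ≠ k`, only the `N` terms with `i = i'` survive; for `j = k` the
trivial bound `N²` suffices. The total is at most `N (N² + N · N)`. -/
theorem integral_squareEnergy_le {N : ℕ} (p : unitInterval) :
    ∫ g, squareEnergy p g ∂SimpleGraph.binomialRandom (Fin N) p ≤ 2 * (N : ℝ) ^ 3 := by
  have habs := fun g i j => abs_centeredAdj_le_one (N := N) p.2.1 p.2.2 g i j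
  have hab2 : ∀ (g : SimpleGraph (Fin N)) i j k,
      |centeredAdj p g i j * centeredAdj p g i k| ≤ 1 := fun g i j k => by
    rw [abs_mul]; exact mul_le_one₀ (habs g i j) (abs_nonneg _) (habs g i k)
  have hoff : ∀ j k : Fin N, j ≠ k → ∫ g, (∑ i, centeredAdj p g i j * centeredAdj p g i k) ^ 2
      ∂SimpleGraph.binomialRandom (Fin N) p ≤ N := by
    intro j k hjk
    simp_rw [sq, Finset.sum_mul_sum]
    rw [integral_finsetSum _ fun _ _ => .of_finite]
    calc _ ≤ ∑ _i : Fin N, (1 : ℝ) := Finset.sum_le_sum fun i _ => ?_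
      _ = N := by simp
    rw [integral_finsetSum _ fun _ _ => .of_finite, Finset.sum_eq_single i]
    · refine (integral_mono .of_finite .of_finite fun g => ?_).trans
        (integral_const (1 : ℝ)).le |>.trans (by simp)
      exact (le_abs_self _).trans (by
        rw [abs_mul]; exact mul_le_one₀ (hab2 g i j k) (abs_nonneg _) (hab2 g i j k))
    · intro i' _ hi'
      exact integral_centeredAdj_rectangle p hi'.symm hjk
    · simp
  have hdiag : ∀ j k : Fin N, ∫ g, (∑ i, centeredAdj p g i j * centeredAdj p g i k) ^ 2
      ∂SimpleGraph.binomialRandom (Fin N) p ≤ (N : ℝ) ^ 2 := by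
    intro j k
    refine (integral_mono .of_finite .of_finite fun g => ?_).trans
        (integral_const ((N : ℝ) ^ 2)).le |>.trans (by simp)
    refine sq_le_sq' ?_ ?_ <;> [rw [neg_le]; skip]
    · refine (neg_le_abs _).trans ((Finset.abs_sum_le_sum_abs _ _).trans ?_)
      exact (Finset.sum_le_sum fun i _ => hab2 g i j k).trans (by simp)
    · refine (le_abs_self _).trans ((Finset.abs_sum_le_sum_abs _ _).trans ?_)
      exact (Finset.sum_le_sum fun i _ => hab2 g i j k).trans (by simp)
  unfold squareEnergy
  rw [integral_finsetSum _ fun _ _ => .of_finite]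
  calc _ ≤ ∑ _j : Fin N, 2 * (N : ℝ) ^ 2 := Finset.sum_le_sum fun j _ => ?_
    _ = 2 * (N : ℝ) ^ 3 := by simp; ring
  rw [integral_finsetSum _ fun _ _ => .of_finite,
    ← Finset.add_sum_erase _ _ (Finset.mem_univ j), two_mul]
  refine add_le_add (hdiag j j) ?_
  refine (Finset.sum_le_sum fun k hk => hoff j k (Finset.ne_of_mem_erase hk).symm).trans ?_
  rw [Finset.sum_const, nsmul_eq_mul, sq]
  gcongr
  exact (Finset.card_le_univ _).trans (by simp)

/-- All bounded functions have, on average, the same mean over the neighbourhood of a vertex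
(normalised by the mean degree) as over all vertices, up to an error `η`. -/
def IsBalanced {N : ℕ} (p : ℝ) (g : SimpleGraph (Fin N)) (η : ℝ) : Prop :=
  ∀ v : Fin N → ℝ, (∀ i, |v i| ≤ 1) →
    ∑ i, |1 / (((N : ℝ) - 1) * p) * ∑ j, edgeIndicator g i j * v j - 1 / (N : ℝ) * ∑ j, v j| ≤
      η * N

/-- With `W = BᵀB`, Cauchy–Schwarz on the `N²` entries bounds `∑ |W j k|`, which dominates `‖B v‖₂²`
for every `|v| ≤ 1`; Cauchy–Schwarz over the `N` vertices then passes to the ℓ¹ norm. The hypothesis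
does not involve `v`, whence the uniformity. -/
theorem sum_abs_centeredAdj_le {N : ℕ} {p : ℝ} (g : SimpleGraph (Fin N)) {v : Fin N → ℝ}
    (hv : ∀ i, |v i| ≤ 1) {η : ℝ} (hη : 0 ≤ η) (h : squareEnergy p g ≤ η ^ 4 * (N : ℝ) ^ 4) :
    ∑ i, |∑ j, centeredAdj p g i j * v j| ≤ η * (N : ℝ) ^ 2 := by
  set W : Fin N → Fin N → ℝ := fun j k => ∑ i, centeredAdj p g i j * centeredAdj p g i k
  have h1 : ∑ j, ∑ k, |W j k| ≤ η ^ 2 * (N : ℝ) ^ 3 := by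
    refine abs_le_of_sq_le_sq' ?_ (by positivity) |>.2
    rw [← Finset.sum_product']
    refine (sq_sum_le_card_mul_sum_sq).trans ?_
    simp only [sq_abs]
    rw [Finset.sum_product' (f := fun j k => W j k ^ 2)]
    calc _ ≤ ((N : ℝ) * N) * (η ^ 4 * (N : ℝ) ^ 4) := by
          refine mul_le_mul (by simp) h (Finset.sum_nonneg fun _ _ =>
            Finset.sum_nonneg fun _ _ => sq_nonneg _) (by positivity)
      _ = _ := by ring
  have h2 : ∑ i, (∑ j, centeredAdj p g i j * v j) ^ 2 ≤ η ^ 2 * (N : ℝ) ^ 3 := by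
    have : ∑ i, (∑ j, centeredAdj p g i j * v j) ^ 2 = ∑ j, ∑ k, W j k * (v j * v k) := by
      simp_rw [sq, Finset.sum_mul_sum, W, Finset.sum_mul]
      rw [Finset.sum_comm]
      refine Finset.sum_congr rfl fun j _ => ?_
      rw [Finset.sum_comm]
      exact Finset.sum_congr rfl fun k _ => Finset.sum_congr rfl fun i _ => by ring
    rw [this]
    refine le_trans (Finset.sum_le_sum fun j _ => Finset.sum_le_sum fun k _ => ?_) h1
    refine (le_abs_self _).trans ?_
    rw [abs_mul, abs_mul]
    exact mul_le_of_le_one_right (abs_nonneg _)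
      (mul_le_one₀ (hv j) (abs_nonneg _) (hv k))
  refine abs_le_of_sq_le_sq' ?_ (by positivity) |>.2
  refine (sq_sum_le_card_mul_sum_sq).trans ?_
  simp only [sq_abs, Finset.card_univ, Fintype.card_fin]
  calc _ ≤ (N : ℝ) * (η ^ 2 * (N : ℝ) ^ 3) := by gcongr
    _ = _ := by ring

theorem isBalanced_of_squareEnergy_le {N : ℕ} (hN : 2 ≤ N) {p : ℝ} (hp : 0 < p)
    (g : SimpleGraph (Fin N)) {η : ℝ} (hη : 0 ≤ η) (h : squareEnergy p g ≤ η ^ 4 * (N : ℝ) ^ 4) :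
    IsBalanced p g (2 * η / p + 4 / N) := by
  intro v hv
  have hN' : (2 : ℝ) ≤ N := by exact_mod_cast hN
  have hN1 : (0 : ℝ) < (N : ℝ) - 1 := by linarith
  have hinv : 1 / ((N : ℝ) - 1) ≤ 2 / N := by
    rw [div_le_div_iff₀ hN1 (by linarith)]; linarith
  have hsum : |∑ j, v j| ≤ N := (Finset.abs_sum_le_sum_abs _ _).trans
    ((Finset.sum_le_sum fun i _ => hv i).trans (by simp))
  have hterm : ∀ i, |1 / (((N : ℝ) - 1) * p) * ∑ j, edgeIndicator g i j * v j -
      1 / (N : ℝ) * ∑ j, v j| ≤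
      1 / (((N : ℝ) - 1) * p) * |∑ j, centeredAdj p g i j * v j| + 2 * (1 / ((N : ℝ) - 1)) := by
    intro i
    have hdec : ∑ j, edgeIndicator g i j * v j =
        ∑ j, centeredAdj p g i j * v j + p * (∑ j, v j - v i) := by
      have : ∀ j, edgeIndicator g i j * v j = centeredAdj p g i j * v j + p * v j -
          (if i = j then p * v j else 0) := by
        intro j
        by_cases hij : i = j
        · subst hij; simp [centeredAdj, edgeIndicator]
        · simp [centeredAdj, hij]; ring
      simp_rw [this]
      rw [Finset.sum_sub_distrib, Finset.sum_add_distrib, ← Finset.mul_sum,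
        Finset.sum_ite_eq Finset.univ i]
      simp; ring
    -- The last term collects the two corrections of order `1 / N`: normalising by `N - 1` instead
    -- of `N`, and the absence of loops.
    have heq : 1 / (((N : ℝ) - 1) * p) * ∑ j, edgeIndicator g i j * v j -
        1 / (N : ℝ) * ∑ j, v j = 1 / (((N : ℝ) - 1) * p) * ∑ j, centeredAdj p g i j * v j +
        1 / ((N : ℝ) - 1) * ((∑ j, v j) / N - v i) := by
      rw [hdec]
      field_simp
      ring
    rw [heq]
    refine (abs_add_le _ _).trans ?_
    rw [abs_mul, abs_mul, abs_of_nonneg (by positivity : 0 ≤ 1 / (((N : ℝ) - 1) * p)),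
      abs_of_nonneg (by positivity : 0 ≤ 1 / ((N : ℝ) - 1)), mul_comm (2 : ℝ)]
    gcongr
    refine (abs_sub _ _).trans ?_
    have : |(∑ j, v j) / (N : ℝ)| ≤ 1 := by
      rw [abs_div, Nat.abs_cast]
      exact div_le_one_of_le₀ hsum (by positivity)
    linarith [hv i]
  calc _ ≤ ∑ i, (1 / (((N : ℝ) - 1) * p) * |∑ j, centeredAdj p g i j * v j| +
        2 * (1 / ((N : ℝ) - 1))) := Finset.sum_le_sum fun i _ => hterm i
    _ = 1 / ((N : ℝ) - 1) * (1 / p) * ∑ i, |∑ j, centeredAdj p g i j * v j| +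
        N * (2 * (1 / ((N : ℝ) - 1))) := by
      rw [Finset.sum_add_distrib, ← Finset.mul_sum, one_div_mul_one_div]; simp
    _ ≤ 2 / N * (1 / p) * (η * (N : ℝ) ^ 2) + N * (2 * (2 / N)) := by
      gcongr
      exact sum_abs_centeredAdj_le g hv hη h
    _ = (2 * η / p + 4 / N) * N := by
      field_simp
      ring

theorem tendsto_measure_not_isBalanced {Ω : ℕ → Type*} [∀ N, MeasurableSpace (Ω N)]
    {P : ∀ N, Measure (Ω N)}
    {G : ∀ N, Ω N → SimpleGraph (Fin N)} {p : unitInterval} (hp : 0 < p)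
    (hG : ∀ N, HasLaw (G N) (SimpleGraph.binomialRandom (Fin N) p) (P N)) {η : ℝ} (hη : 0 < η) :
    Tendsto (fun N => P N {ω | ¬ IsBalanced p (G N ω) η}) atTop (𝓝 0) := by
  have hp' : 0 < (p : ℝ) := hp
  set η' : ℝ := η * p / 4 with hη'
  have hη'0 : 0 < η' := by positivity
  -- Markov's inequality gives `2N³ / (η'⁴ N⁴)`. The choice of `η'` and `N ≥ 8 / η` make each of the
  -- two terms of the balance error at most `η / 2`.
  have hlim : Tendsto (fun N : ℕ => ENNReal.ofReal (2 / η' ^ 4 / N)) atTop (𝓝 0) := by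
    rw [← ENNReal.ofReal_zero]
    exact ENNReal.tendsto_ofReal (tendsto_const_div_atTop_nhds_zero_nat _)
  refine tendsto_of_tendsto_of_tendsto_of_le_of_le' tendsto_const_nhds hlim
    (Eventually.of_forall fun _ => zero_le) ?_
  filter_upwards [eventually_ge_atTop 2, eventually_ge_atTop ⌈8 / η⌉₊] with N hN2 hN8
  have hN0 : (0 : ℝ) < N := by exact_mod_cast (by omega : 0 < N)
  have hN8' : 8 / η ≤ N := (Nat.le_ceil _).trans (by exact_mod_cast hN8)
  have hle : 2 * η' / p + 4 / N ≤ η := by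
    have h1 : 2 * η' / p = η / 2 := by rw [hη']; field_simp; norm_num
    have h2 : 4 / (N : ℝ) ≤ η / 2 := by
      rw [div_le_iff₀ hη] at hN8'
      rw [div_le_div_iff₀ hN0 two_pos]; linarith
    linarith
  set A : Set (SimpleGraph (Fin N)) := {g | η' ^ 4 * (N : ℝ) ^ 4 ≤ squareEnergy p g}
  have hsub : {ω | ¬ IsBalanced p (G N ω) η} ⊆ G N ⁻¹' A := by
    intro ω hω
    by_contra hA
    simp only [A, Set.mem_preimage, Set.mem_ofPred_eq, not_le] at hA
    refine hω fun v hv => (isBalanced_of_squareEnergy_le hN2 hp' _ hη'0.le hA.le v hv).trans ?_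
    gcongr
  have hreal := mul_meas_ge_le_integral_of_nonneg
    (μ := SimpleGraph.binomialRandom (Fin N) p) (f := fun g => squareEnergy p g)
    (Eventually.of_forall fun g => Finset.sum_nonneg fun _ _ => Finset.sum_nonneg fun _ _ =>
      sq_nonneg _) .of_finite (η' ^ 4 * (N : ℝ) ^ 4)
  have hreal2 := hreal.trans (integral_squareEnergy_le p)
  calc P N {ω | ¬ IsBalanced p (G N ω) η} ≤ P N (G N ⁻¹' A) := measure_mono hsub
    _ = SimpleGraph.binomialRandom (Fin N) p A := by
      rw [← (hG N).map_eq, Measure.map_apply_of_aemeasurable (hG N).aemeasurable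
        (Set.toFinite A).measurableSet]
    _ = ENNReal.ofReal ((SimpleGraph.binomialRandom (Fin N) p).real A) :=
      (ofReal_measureReal).symm
    _ ≤ ENNReal.ofReal (2 / η' ^ 4 / N) := by
      refine ENNReal.ofReal_le_ofReal ?_
      rw [div_div, le_div_iff₀ (by positivity)]
      refine le_of_mul_le_mul_left ?_ (by positivity : (0 : ℝ) < (N : ℝ) ^ 3)
      calc _ = η' ^ 4 * (N : ℝ) ^ 4 * (SimpleGraph.binomialRandom (Fin N) p).real A := by ring
        _ ≤ 2 * (N : ℝ) ^ 3 := hreal2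
        _ = _ := by ring

/-! ### The averaged drift -/

theorem RateBound.mono {S : ℕ} {q : Fin S → Fin S → (Fin S → ℝ) → ℝ} {R K K' : ℝ}
    (h : RateBound q R K) (hK : K ≤ K') : RateBound q R K' where
  nonneg := h.nonneg.trans hK
  rate_le k s hks φ hφ := (h.rate_le k s hks φ hφ).trans hK
  norm_mulVec_le φ v hφ := (h.norm_mulVec_le φ v hφ).trans (by gcongr)
  norm_mulVec_sub_le φ ψ v hφ hψ := (h.norm_mulVec_sub_le φ ψ v hφ hψ).trans (by gcongr)

theorem edgeIndicator_nonneg {N : ℕ} (g : SimpleGraph (Fin N)) (i j : Fin N) :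
    0 ≤ edgeIndicator g i j := by
  unfold edgeIndicator; split_ifs <;> simp

theorem edgeIndicator_le_one {N : ℕ} (g : SimpleGraph (Fin N)) (i j : Fin N) :
    edgeIndicator g i j ≤ 1 := by
  unfold edgeIndicator; split_ifs <;> simp

theorem environment_apply {N S : ℕ} (p : ℝ) (g : SimpleGraph (Fin N)) (v : Fin N → Fin S → ℝ)
    (i : Fin N) (s : Fin S) : environment p g v i s =
      1 / (((N : ℝ) - 1) * p) * ∑ j, edgeIndicator g i j * v j s := by
  simp [environment, Finset.sum_apply]

theorem average_apply {N S : ℕ} (v : Fin N → Fin S → ℝ) (s : Fin S) :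
    average v s = 1 / (N : ℝ) * ∑ i, v i s := by
  simp [average, Finset.sum_apply]

theorem environment_eq_sum {N S : ℕ} (p : ℝ) (g : SimpleGraph (Fin N)) (v : Fin N → Fin S → ℝ)
    (i : Fin N) : environment p g v i =
      ∑ j, (1 / (((N : ℝ) - 1) * p) * edgeIndicator g i j) • v j := by
  simp [environment, Finset.smul_sum, smul_smul]

/-- A degree is at most `N`, and `N / (N - 1) ≤ 2`. This deterministic bound fixes the radius `2 /
p` on which the rates are controlled, with no need for degree concentration. -/
theorem norm_environment_le {N S : ℕ} (hN : 2 ≤ N) {p : ℝ} (hp : 0 < p) (g : SimpleGraph (Fin N))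
    {v : Fin N → Fin S → ℝ} (hv : ∀ i, v i ∈ stdSimplex ℝ (Fin S)) (i : Fin N) :
    ‖environment p g v i‖ ≤ 2 / p := by
  have hN' : (2 : ℝ) ≤ N := by exact_mod_cast hN
  have hN1 : (0 : ℝ) < (N : ℝ) - 1 := by linarith
  rw [environment, norm_smul, Real.norm_of_nonneg (by positivity)]
  calc _ ≤ 1 / (((N : ℝ) - 1) * p) * ∑ _j : Fin N, (1 : ℝ) := by
        refine mul_le_mul_of_nonneg_left ((norm_sum_le _ _).trans
          (Finset.sum_le_sum fun j _ => ?_)) (by positivity)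
        rw [norm_smul, Real.norm_of_nonneg (edgeIndicator_nonneg g i j)]
        exact mul_le_one₀ (edgeIndicator_le_one g i j) (norm_nonneg _)
          (norm_le_one_of_mem_stdSimplex (hv j))
    _ = N / (((N : ℝ) - 1) * p) := by
        rw [Finset.sum_const, Finset.card_univ, Fintype.card_fin, nsmul_one, div_mul_eq_mul_div,
          one_mul]
    _ ≤ 2 / p := by
        rw [div_le_div_iff₀ (by positivity) hp]
        nlinarith

theorem average_mem_stdSimplex {N S : ℕ} (hN : 0 < N) {v : Fin N → Fin S → ℝ}
    (hv : ∀ i, v i ∈ stdSimplex ℝ (Fin S)) : average v ∈ stdSimplex ℝ (Fin S) := by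
  have hN' : (N : ℝ) ≠ 0 := by exact_mod_cast hN.ne'
  refine ⟨fun s => ?_, ?_⟩
  · rw [average_apply]
    exact mul_nonneg (by positivity) (Finset.sum_nonneg fun i _ => (hv i).1 s)
  · simp_rw [average_apply]
    rw [← Finset.mul_sum, Finset.sum_comm, Finset.sum_congr rfl fun i _ => (hv i).2]
    simp [hN']

theorem norm_le_sum_abs {S : ℕ} (v : Fin S → ℝ) : ‖v‖ ≤ ∑ s, |v s| :=
  (pi_norm_le_iff_of_nonneg (Finset.sum_nonneg fun _ _ => abs_nonneg _)).2 fun s =>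
    Finset.single_le_sum (f := fun s => |v s|) (fun _ _ => abs_nonneg _) (Finset.mem_univ s)

theorem sum_abs_le_mul_norm {S : ℕ} (v : Fin S → ℝ) : ∑ s, |v s| ≤ S * ‖v‖ :=
  (Finset.sum_le_sum fun s _ => norm_le_pi_norm v s).trans (by simp)

theorem norm_average_le {N S : ℕ} (v : Fin N → Fin S → ℝ) :
    ‖average v‖ ≤ 1 / (N : ℝ) * ∑ i, ‖v i‖ := by
  rw [average, norm_smul, Real.norm_of_nonneg (by positivity)]
  gcongr
  exact norm_sum_le _ _

theorem IsBalanced.sum_norm_environment_sub_le {N S : ℕ} {p η : ℝ} {g : SimpleGraph (Fin N)}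
    (hg : IsBalanced p g η) {v : Fin N → Fin S → ℝ} (hv : ∀ i, v i ∈ stdSimplex ℝ (Fin S)) :
    ∑ i, ‖environment p g v i - average v‖ ≤ S * η * N := by
  calc _ ≤ ∑ i, ∑ s, |(environment p g v i - average v) s| :=
        Finset.sum_le_sum fun i _ => norm_le_sum_abs _
    _ = ∑ s, ∑ i, |environment p g v i s - average v s| := Finset.sum_comm
    _ ≤ ∑ _s : Fin S, η * N := by
        refine Finset.sum_le_sum fun s _ => ?_
        simp_rw [environment_apply, average_apply]
        exact hg (fun i => v i s) fun i =>
          (norm_le_pi_norm (v i) s).trans (norm_le_one_of_mem_stdSimplex (hv i))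
    _ = S * η * N := by simp; ring

/-- On a balanced graph, the average of the drifts is close to the mean-field drift. -/
theorem IsBalanced.norm_average_drift_sub_le {N S : ℕ} (hN : 2 ≤ N) {p η K : ℝ} (hp : 0 < p)
    (hp1 : p ≤ 1) {q : Fin S → Fin S → (Fin S → ℝ) → ℝ} (hK : RateBound q (2 / p) K)
    {g : SimpleGraph (Fin N)} (hg : IsBalanced p g η) {v : Fin N → Fin S → ℝ}
    (hv : ∀ i, v i ∈ stdSimplex ℝ (Fin S)) :
    ‖average (fun i => rateMatrix q (environment p g v i) *ᵥ v i) -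
      rateMatrix q (average v) *ᵥ average v‖ ≤ K * S * η := by
  have hN0 : (0 : ℝ) < N := by exact_mod_cast (by omega : 0 < N)
  have hR : 1 ≤ 2 / p := by rw [le_div_iff₀ hp]; linarith
  have havg : ‖average v‖ ≤ 2 / p :=
    (norm_le_one_of_mem_stdSimplex (average_mem_stdSimplex (by omega) hv)).trans hR
  -- With the matrix frozen at the average, the drift is linear in the state, so only the
  -- discrepancy between environment and average remains.
  have heq : average (fun i => rateMatrix q (environment p g v i) *ᵥ v i) -
      rateMatrix q (average v) *ᵥ average v = average fun i =>
        rateMatrix q (environment p g v i) *ᵥ v i - rateMatrix q (average v) *ᵥ v i := by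
    have : rateMatrix q (average v) *ᵥ average v =
        (1 / (N : ℝ)) • ∑ i, rateMatrix q (average v) *ᵥ v i := by
      conv_lhs => rw [show average v = (1 / (N : ℝ)) • ∑ i, v i from rfl]
      rw [Matrix.mulVec_smul, Matrix.mulVec_sum]
      rfl
    rw [this]
    simp only [average, ← smul_sub, ← Finset.sum_sub_distrib]
  rw [heq]
  refine (norm_average_le _).trans ?_
  calc _ ≤ 1 / (N : ℝ) * ∑ i, K * ‖environment p g v i - average v‖ := by
        gcongr with i
        refine (hK.norm_mulVec_sub_le _ _ _ (norm_environment_le hN hp g hv i) havg).trans ?_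
        exact mul_le_of_le_one_right (mul_nonneg hK.nonneg (norm_nonneg _))
          (norm_le_one_of_mem_stdSimplex (hv i))
    _ ≤ 1 / (N : ℝ) * (K * (S * η * N)) := by
        rw [← Finset.mul_sum]
        gcongr
        · exact hK.nonneg
        · exact hg.sum_norm_environment_sub_le hv
    _ = K * S * η := by field_simp

theorem RateBound.norm_drift_sub_le {S : ℕ} {q : Fin S → Fin S → (Fin S → ℝ) → ℝ}
    {R K : ℝ} (hK : RateBound q R K) (hR : 1 ≤ R) {v w : Fin S → ℝ}
    (hv : v ∈ stdSimplex ℝ (Fin S)) (hw : w ∈ stdSimplex ℝ (Fin S)) :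
    ‖rateMatrix q v *ᵥ v - rateMatrix q w *ᵥ w‖ ≤ 2 * K * ‖v - w‖ := by
  have hv1 := norm_le_one_of_mem_stdSimplex hv
  have hw1 := norm_le_one_of_mem_stdSimplex hw
  have h1 : K * ‖v - w‖ * ‖v‖ ≤ K * ‖v - w‖ :=
    mul_le_of_le_one_right (mul_nonneg hK.nonneg (norm_nonneg _)) hv1
  linarith [hK.norm_mulVec_sub_mulVec_le v w (hv1.trans hR) (hw1.trans hR)]

/-- This is the interacting system with a single particle of weight `1` on itself. -/
theorem IsMeanFieldSolution.mem_stdSimplex {S : ℕ} {q : Fin S → Fin S → (Fin S → ℝ) → ℝ}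
    (hq_lip : ∀ k s, k ≠ s → LocallyLipschitz (q k s))
    (hq_nonneg : ∀ k s, k ≠ s → ∀ φ : Fin S → ℝ, (∀ l, 0 ≤ φ l) → 0 ≤ q k s φ)
    {u : ℝ → Fin S → ℝ} (hu : IsMeanFieldSolution q u) {t : ℝ} (ht : 0 ≤ t) :
    u t ∈ stdSimplex ℝ (Fin S) :=
  mem_stdSimplex_of_hasDerivWithinAt (ι := Unit) hq_lip hq_nonneg (w := fun _ _ => 1)
    (fun _ _ => zero_le_one) (z := fun t _ => u t) (fun _ => hu.1)
    (fun t ht _ => by simpa using hu.2 t ht) ht ()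

theorem IsNIMFASolution.mem_stdSimplex {N S : ℕ} (hN : 1 ≤ N) {p : ℝ} (hp : 0 ≤ p)
    {q : Fin S → Fin S → (Fin S → ℝ) → ℝ}
    (hq_lip : ∀ k s, k ≠ s → LocallyLipschitz (q k s))
    (hq_nonneg : ∀ k s, k ≠ s → ∀ φ : Fin S → ℝ, (∀ l, 0 ≤ φ l) → 0 ≤ q k s φ)
    {g : SimpleGraph (Fin N)} {z : ℝ → Fin N → Fin S → ℝ} (hz : IsNIMFASolution p q g z)
    {t : ℝ} (ht : 0 ≤ t) (i : Fin N) : z t i ∈ stdSimplex ℝ (Fin S) := by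
  have hN' : (1 : ℝ) ≤ N := by exact_mod_cast hN
  exact mem_stdSimplex_of_hasDerivWithinAt hq_lip hq_nonneg
    (w := fun i j => 1 / (((N : ℝ) - 1) * p) * edgeIndicator g i j)
    (fun i j => mul_nonneg (one_div_nonneg.2 (mul_nonneg (by linarith) hp))
      (edgeIndicator_nonneg g i j)) hz.1
    (fun t ht i => by simpa only [environment_eq_sum] using hz.2 t ht i) ht i

/-! ### Convergence of the NIMFA average -/

theorem tendstoZeroInProbability_of_real {Ω : ℕ → Type*} [∀ N, MeasurableSpace (Ω N)]
    {P : ∀ N, Measure (Ω N)} {X : ∀ N, Ω N → ℝ≥0∞}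
    (h : ∀ ε : ℝ, 0 < ε → Tendsto (fun N => P N {ω | ENNReal.ofReal ε ≤ X N ω}) atTop (𝓝 0)) :
    TendstoZeroInProbability P X := by
  intro ε hε
  -- Truncation at `1` covers the threshold `ε = ∞`.
  have hne : min ε 1 ≠ ∞ := ne_top_of_le_ne_top ENNReal.one_ne_top (min_le_right _ _)
  have hpos : 0 < (min ε 1).toReal :=
    ENNReal.toReal_pos (lt_min hε zero_lt_one).ne' hne
  refine tendsto_of_tendsto_of_tendsto_of_le_of_le tendsto_const_nhds (h _ hpos)
    (fun _ => zero_le) fun N => measure_mono fun ω hω => ?_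
  rw [Set.mem_ofPred_eq, ENNReal.ofReal_toReal hne]
  exact (min_le_left _ _).trans hω

theorem norm_sub_lt_of_dist₁_lt {S : ℕ} {v w : Fin S → ℝ} {a : ℝ}
    (h : dist₁ v w < ENNReal.ofReal a) : ‖v - w‖ < a := by
  refine (norm_le_sum_abs _).trans_lt ?_
  exact (ENNReal.ofReal_lt_ofReal_iff_of_nonneg (Finset.sum_nonneg fun _ _ => abs_nonneg _)).1 h

theorem dist₁_le_of_norm_sub_le {S : ℕ} {v w : Fin S → ℝ} {a : ℝ} (h : ‖v - w‖ ≤ a) :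
    dist₁ v w ≤ ENNReal.ofReal (S * a) :=
  ENNReal.ofReal_le_ofReal ((sum_abs_le_mul_norm (v - w)).trans (by gcongr))

theorem hasDerivWithinAt_average {N S : ℕ} {z : ℝ → Fin N → Fin S → ℝ} {z' : Fin N → Fin S → ℝ}
    {A : Set ℝ} {t : ℝ} (h : ∀ i, HasDerivWithinAt (fun r => z r i) (z' i) A t) :
    HasDerivWithinAt (fun r => average (z r)) (average z') A t :=
  (HasDerivWithinAt.fun_sum fun i _ => h i).const_smul (1 / (N : ℝ))

theorem IsNIMFASolution.norm_average_sub_le {N S : ℕ} (hN : 2 ≤ N) {p η K δ T : ℝ} (hp : 0 < p)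
    (hp1 : p ≤ 1) {q : Fin S → Fin S → (Fin S → ℝ) → ℝ}
    (hq_lip : ∀ k s, k ≠ s → LocallyLipschitz (q k s))
    (hq_nonneg : ∀ k s, k ≠ s → ∀ φ : Fin S → ℝ, (∀ l, 0 ≤ φ l) → 0 ≤ q k s φ)
    (hK : RateBound q (2 / p) K) (hK1 : 1 ≤ K) {g : SimpleGraph (Fin N)} (hη : 0 ≤ η)
    (hg : IsBalanced p g η) {z : ℝ → Fin N → Fin S → ℝ} (hz : IsNIMFASolution p q g z)
    {u : ℝ → Fin S → ℝ} (hu : IsMeanFieldSolution q u) (hδ : ‖average (z 0) - u 0‖ ≤ δ)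
    {t : ℝ} (ht : t ∈ Set.Icc 0 T) :
    ‖average (z t) - u t‖ ≤ (δ + K * S * η) * Real.exp (2 * K * T) := by
  have hzm : ∀ t, 0 ≤ t → ∀ i, z t i ∈ stdSimplex ℝ (Fin S) := fun t ht i =>
    hz.mem_stdSimplex (by omega) hp.le hq_lip hq_nonneg ht i
  have hR : 1 ≤ 2 / p := by rw [le_div_iff₀ hp]; linarith
  have hz' : ∀ t, 0 ≤ t → HasDerivWithinAt (fun r => average (z r))
      (average fun i => rateMatrix q (environment p g (z t) i) *ᵥ z t i) (Set.Ici 0) t :=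
    fun t ht => hasDerivWithinAt_average (hz.2 t ht)
  -- The mean-field drift is `2K`-Lipschitz on the simplex, where both curves stay; the average of
  -- `z` solves the equation up to `K S η`.
  have key := dist_le_of_approx_trajectories_ODE_of_mem (a := 0) (b := T)
    (v := fun _ x => rateMatrix q x *ᵥ x) (s := fun _ => stdSimplex ℝ (Fin S))
    (K := (2 * K).toNNReal) (f := fun r => average (z r)) (g := u) (εf := K * S * η) (εg := 0)
    (δ := δ)
    (fun _ _ => LipschitzOnWith.of_dist_le_mul fun x hx y hy => by
      rw [dist_eq_norm, dist_eq_norm, Real.coe_toNNReal _ (by linarith)]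
      exact hK.norm_drift_sub_le hR hx hy)
    (fun r hr => (hz' r hr.1).continuousWithinAt.mono Set.Icc_subset_Ici_self)
    (fun r hr => (hz' r hr.1).mono (Set.Ici_subset_Ici.2 hr.1))
    (fun r hr => by
      rw [dist_eq_norm]
      exact hg.norm_average_drift_sub_le hN hp hp1 hK (hzm r hr.1))
    (fun r hr => average_mem_stdSimplex (by omega) (hzm r hr.1))
    (fun r hr => (hu.2 r hr.1).continuousWithinAt.mono Set.Icc_subset_Ici_self)
    (fun r hr => (hu.2 r hr.1).mono (Set.Ici_subset_Ici.2 hr.1))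
    (fun r _ => by simp)
    (fun r hr => hu.mem_stdSimplex hq_lip hq_nonneg hr.1)
    (by rwa [dist_eq_norm]) t ht
  rw [dist_eq_norm, sub_zero, add_zero, Real.coe_toNNReal _ (by linarith)] at key
  refine key.trans ?_
  have hδ0 : 0 ≤ δ := (norm_nonneg _).trans hδ
  have hc : 0 ≤ K * S * η := by positivity
  rw [gronwallBound_of_K_ne_0 (by linarith)]
  have he : Real.exp (2 * K * t) ≤ Real.exp (2 * K * T) :=
    Real.exp_le_exp.2 (mul_le_mul_of_nonneg_left ht.2 (by linarith))
  have he1 : 1 ≤ Real.exp (2 * K * t) :=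
    Real.one_le_exp (mul_nonneg (by linarith) ht.1)
  calc δ * Real.exp (2 * K * t) + K * S * η / (2 * K) * (Real.exp (2 * K * t) - 1)
      ≤ δ * Real.exp (2 * K * T) + K * S * η * Real.exp (2 * K * T) := by
        gcongr
        · exact div_le_self hc (by linarith)
        · linarith
    _ = _ := by ring

theorem tendstoZeroInProbability_nimfa {S : ℕ} {q : Fin S → Fin S → (Fin S → ℝ) → ℝ}
    (hq_lip : ∀ k s, k ≠ s → LocallyLipschitz (q k s))
    (hq_nonneg : ∀ k s, k ≠ s → ∀ φ : Fin S → ℝ, (∀ l, 0 ≤ φ l) → 0 ≤ q k s φ)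
    {p : unitInterval} (hp : 0 < p)
    {Ω : ℕ → Type*} [∀ N, MeasurableSpace (Ω N)] {P : ∀ N, Measure (Ω N)}
    {G : ∀ N, Ω N → SimpleGraph (Fin N)}
    (hG : ∀ N, HasLaw (G N) (SimpleGraph.binomialRandom (Fin N) p) (P N))
    {z : ∀ N, Ω N → ℝ → Fin N → Fin S → ℝ}
    (hz : ∀ N, ∀ᵐ ω ∂(P N), IsNIMFASolution p q (G N ω) (z N ω))
    {u : ℝ → Fin S → ℝ} (hu : IsMeanFieldSolution q u)
    (h0 : TendstoZeroInProbability P (fun N ω => dist₁ (average (z N ω 0)) (u 0))) (T : ℝ) :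
    TendstoZeroInProbability P (fun N ω =>
      ⨆ t ∈ Set.Icc (0 : ℝ) T, dist₁ (average (z N ω t)) (u t)) := by
  have hp' : 0 < (p : ℝ) := hp
  obtain ⟨K, hK⟩ := exists_rateBound hq_lip (R := 2 / p)
  -- Having `K ≥ 1` allows division by `2K` in the Grönwall bound.
  replace hK := hK.mono (le_max_left K 1)
  have hK1 : 1 ≤ max K 1 := le_max_right _ _
  set K' := max K 1
  refine tendstoZeroInProbability_of_real fun ε hε => ?_
  obtain ⟨a, ha, haε⟩ := exists_pos_mul_lt hε (S * ((1 + K' * S) * Real.exp (2 * K' * T)))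
  have hlim := (h0 (ENNReal.ofReal a) (ENNReal.ofReal_pos.2 ha)).add
    (tendsto_measure_not_isBalanced hp hG ha)
  rw [add_zero] at hlim
  refine tendsto_of_tendsto_of_tendsto_of_le_of_le' tendsto_const_nhds hlim
    (Eventually.of_forall fun _ => zero_le) ?_
  filter_upwards [eventually_ge_atTop 2] with N hN
  refine le_trans (measure_mono_ae ?_) (measure_union_le _ _)
  filter_upwards [hz N] with ω hω hε'
  by_contra hcon
  have hinit : dist₁ (average (z N ω 0)) (u 0) < ENNReal.ofReal a :=
    not_le.1 fun h => hcon (Or.inl h)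
  have hbal : IsBalanced p (G N ω) a := by_contra fun h => hcon (Or.inr h)
  refine absurd (show ENNReal.ofReal ε ≤ _ from hε') (not_le.2 ?_)
  refine lt_of_le_of_lt (iSup₂_le fun t ht => ?_)
    ((ENNReal.ofReal_lt_ofReal_iff hε).2 haε)
  have h1 : ‖average (z N ω t) - u t‖ ≤ (1 + K' * S) * Real.exp (2 * K' * T) * a :=
    (hω.norm_average_sub_le hN hp' p.2.2 hq_lip hq_nonneg hK hK1 ha.le
      hbal hu (norm_sub_lt_of_dist₁_lt hinit).le ht).trans (by linarith)
  exact (dist₁_le_of_norm_sub_le h1).trans (by rw [mul_assoc (S : ℝ)])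

/-! ### A maximal inequality -/

section Maximal

variable {Ω : Type*} {m0 : MeasurableSpace Ω} {μ : Measure Ω}

/-- The increment `X (j + 1) - X j` minus its conditional expectation given `ℱ j`. -/
noncomputable def innovation (μ : Measure Ω) (ℱ : Filtration ℕ m0) (X : ℕ → Ω → ℝ) (j : ℕ) :
    Ω → ℝ :=
  X (j + 1) - X j - μ[X (j + 1) - X j | ℱ j]

variable {ℱ : Filtration ℕ m0} {X : ℕ → Ω → ℝ}

theorem stronglyMeasurable_innovation (hadp : StronglyAdapted ℱ X) (j : ℕ) :
    StronglyMeasurable[ℱ (j + 1)] (innovation μ ℱ X j) :=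
  ((hadp (j + 1)).sub ((hadp j).mono (ℱ.mono j.le_succ))).sub
    (stronglyMeasurable_condExp.mono (ℱ.mono j.le_succ))

theorem stronglyMeasurable_sum_innovation (hadp : StronglyAdapted ℱ X) (k : ℕ) :
    StronglyMeasurable[ℱ k] fun ω => ∑ j ∈ Finset.range k, innovation μ ℱ X j ω :=
  Finset.stronglyMeasurable_fun_sum _ fun j hj =>
    (stronglyMeasurable_innovation hadp j).mono (ℱ.mono (Finset.mem_range.1 hj))

theorem memLp_innovation (hX : ∀ n, MemLp (X n) 2 μ) (j : ℕ) :
    MemLp (innovation μ ℱ X j) 2 μ :=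
  ((hX _).sub (hX _)).sub (((hX _).sub (hX _)).condExp one_le_two)

theorem memLp_sum_innovation (hX : ∀ n, MemLp (X n) 2 μ) (k : ℕ) :
    MemLp (fun ω => ∑ j ∈ Finset.range k, innovation μ ℱ X j ω) 2 μ :=
  memLp_finsetSum _ fun j _ => memLp_innovation hX j

variable [IsProbabilityMeasure μ]

theorem condExp_mul_innovation (hX : ∀ n, MemLp (X n) 2 μ) {j : ℕ} {Y : Ω → ℝ}
    (hY : StronglyMeasurable[ℱ j] Y) (hY2 : MemLp Y 2 μ) :
    μ[Y * innovation μ ℱ X j | ℱ j] =ᵐ[μ] 0 := by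
  have hint : Integrable (X (j + 1) - X j) μ :=
    ((hX _).sub (hX _)).integrable one_le_two
  have h0 : μ[innovation μ ℱ X j | ℱ j] =ᵐ[μ] 0 := by
    refine (condExp_sub hint integrable_condExp (ℱ j)).trans ?_
    rw [condExp_of_stronglyMeasurable (ℱ.le j) stronglyMeasurable_condExp integrable_condExp,
      sub_self]
  refine (condExp_mul_of_stronglyMeasurable_left hY (hY2.integrable_mul (memLp_innovation hX j))
    ((memLp_innovation hX j).integrable one_le_two)).trans ?_
  filter_upwards [h0] with ω hω
  simp [hω]

theorem integral_mul_innovation (hX : ∀ n, MemLp (X n) 2 μ) {j : ℕ} {Y : Ω → ℝ}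
    (hY : StronglyMeasurable[ℱ j] Y) (hY2 : MemLp Y 2 μ) :
    ∫ ω, Y ω * innovation μ ℱ X j ω ∂μ = 0 := by
  have h := integral_condExp (μ := μ) (f := Y * innovation μ ℱ X j) (ℱ.le j)
  rw [integral_congr_ae (condExp_mul_innovation hX hY hY2)] at h
  simpa using h.symm

/-- Conditional expectation is an orthogonal projection in `L²`, so subtracting it cannot increase
the norm. -/
theorem integral_innovation_sq_le (hX : ∀ n, MemLp (X n) 2 μ) (j : ℕ) :
    ∫ ω, innovation μ ℱ X j ω ^ 2 ∂μ ≤ ∫ ω, (X (j + 1) ω - X j ω) ^ 2 ∂μ := by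
  set b : Ω → ℝ := μ[X (j + 1) - X j | ℱ j]
  have hb2 : MemLp b 2 μ := ((hX _).sub (hX _)).condExp one_le_two
  have hD2 := memLp_innovation (ℱ := ℱ) hX j
  have hexp : ∀ ω, (X (j + 1) ω - X j ω) ^ 2 =
      (innovation μ ℱ X j ω ^ 2 + 2 * (b ω * innovation μ ℱ X j ω)) + b ω ^ 2 := by
    intro ω
    have : innovation μ ℱ X j ω = X (j + 1) ω - X j ω - b ω := rfl
    rw [this]; ring
  have hbD : Integrable (fun ω => b ω * innovation μ ℱ X j ω) μ := hb2.integrable_mul hD2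
  simp_rw [hexp]
  rw [integral_add (hD2.integrable_sq.fun_add (hbD.const_mul 2)) hb2.integrable_sq,
    integral_add hD2.integrable_sq (hbD.const_mul 2), integral_const_mul,
    integral_mul_innovation hX stronglyMeasurable_condExp hb2, mul_zero, add_zero]
  exact le_add_of_nonneg_right (integral_nonneg fun ω => sq_nonneg _)

theorem integral_sum_innovation_sq_le (hadp : StronglyAdapted ℱ X)
    (hX : ∀ n, MemLp (X n) 2 μ) (k : ℕ) :
    ∫ ω, (∑ j ∈ Finset.range k, innovation μ ℱ X j ω) ^ 2 ∂μ ≤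
      ∑ j ∈ Finset.range k, ∫ ω, (X (j + 1) ω - X j ω) ^ 2 ∂μ := by
  induction k with
  | zero => simp
  | succ k ih =>
    have hM2 := memLp_sum_innovation (ℱ := ℱ) hX k
    have hD2 := memLp_innovation (ℱ := ℱ) hX k
    have hMD : Integrable (fun ω => (∑ j ∈ Finset.range k, innovation μ ℱ X j ω) *
      innovation μ ℱ X k ω) μ := hM2.integrable_mul hD2
    simp_rw [Finset.sum_range_succ, add_sq, mul_assoc]
    rw [integral_add (hM2.integrable_sq.fun_add (hMD.const_mul 2)) hD2.integrable_sq,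
      integral_add hM2.integrable_sq (hMD.const_mul 2), integral_const_mul,
      integral_mul_innovation hX (stronglyMeasurable_sum_innovation hadp k) hM2, mul_zero,
      add_zero]
    exact add_le_add ih (integral_innovation_sq_le hX k)

/-- In the increment of the square the cross term has zero conditional expectation, leaving a
square. -/
theorem submartingale_sum_innovation_sq (hadp : StronglyAdapted ℱ X)
    (hX : ∀ n, MemLp (X n) 2 μ) :
    Submartingale (fun k ω => (∑ j ∈ Finset.range k, innovation μ ℱ X j ω) ^ 2) ℱ μ := by
  refine submartingale_of_condExp_sub_nonneg_nat
    (fun k => (stronglyMeasurable_sum_innovation hadp k).pow 2)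
    (fun k => (memLp_sum_innovation hX k).integrable_sq) fun k => ?_
  set M : Ω → ℝ := fun ω => ∑ j ∈ Finset.range k, innovation μ ℱ X j ω with hM
  have hM2 : MemLp M 2 μ := memLp_sum_innovation (ℱ := ℱ) hX k
  have hD2 := memLp_innovation (ℱ := ℱ) hX k
  have hMm : StronglyMeasurable[ℱ k] M := stronglyMeasurable_sum_innovation hadp k
  have h2M : MemLp ((2 : ℝ) • M) 2 μ := hM2.const_smul 2
  have heq : ((fun ω => (∑ j ∈ Finset.range (k + 1), innovation μ ℱ X j ω) ^ 2) -
      fun ω => (∑ j ∈ Finset.range k, innovation μ ℱ X j ω) ^ 2) =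
      ((2 : ℝ) • M) * innovation μ ℱ X k + fun ω => innovation μ ℱ X k ω ^ 2 := by
    ext ω
    simp only [Finset.sum_range_succ, Pi.sub_apply, Pi.add_apply, Pi.mul_apply, Pi.smul_apply,
      smul_eq_mul, hM]
    ring
  rw [heq]
  have h1 := condExp_add (h2M.integrable_mul hD2) hD2.integrable_sq (ℱ k)
  have h2 := condExp_mul_innovation hX (hMm.const_smul (2 : ℝ)) h2M
  have h3 : 0 ≤ᵐ[μ] μ[fun ω => innovation μ ℱ X k ω ^ 2 | ℱ k] :=
    condExp_nonneg (Eventually.of_forall fun ω => sq_nonneg _)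
  filter_upwards [h1, h2, h3] with ω h1 h2 h3
  rw [h1, Pi.add_apply, h2]
  simpa using h3

theorem measure_exists_le_abs_sum_innovation (hadp : StronglyAdapted ℱ X)
    (hX : ∀ n, MemLp (X n) 2 μ) {ε : ℝ} (hε : 0 < ε) (m : ℕ) :
    μ {ω | ∃ k ≤ m, ε ≤ |∑ j ∈ Finset.range k, innovation μ ℱ X j ω|} ≤
      ENNReal.ofReal ((∑ j ∈ Finset.range m, ∫ ω, (X (j + 1) ω - X j ω) ^ 2 ∂μ) / ε ^ 2) := by
  have hmax := maximal_ineq (submartingale_sum_innovation_sq hadp hX)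
    (fun k ω => sq_nonneg _) (ε := (ε ^ 2).toNNReal) m
  have hε2 : 0 < ε ^ 2 := by positivity
  rw [Real.coe_toNNReal _ hε2.le] at hmax
  set A := {ω | ε ^ 2 ≤ (Finset.range (m + 1)).sup' Finset.nonempty_range_add_one
    fun k => (∑ j ∈ Finset.range k, innovation μ ℱ X j ω) ^ 2}
  have hsub : {ω | ∃ k ≤ m, ε ≤ |∑ j ∈ Finset.range k, innovation μ ℱ X j ω|} ⊆ A := by
    rintro ω ⟨k, hk, hle⟩
    refine le_trans ?_ (Finset.le_sup' (fun k => (∑ j ∈ Finset.range k, innovation μ ℱ X j ω) ^ 2)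
      (Finset.mem_range.2 (Nat.lt_succ_of_le hk)))
    rw [← sq_abs (∑ j ∈ Finset.range k, _)]
    gcongr
  refine (measure_mono hsub).trans ?_
  rw [ENNReal.ofReal_div_of_pos hε2, ENNReal.le_div_iff_mul_le (Or.inl (by simpa using hε.ne'))
    (Or.inl ENNReal.ofReal_ne_top), mul_comm]
  refine hmax.trans (ENNReal.ofReal_le_ofReal ?_)
  exact (setIntegral_le_integral (memLp_sum_innovation hX m).integrable_sq
    (Eventually.of_forall fun ω => sq_nonneg _)).trans (integral_sum_innovation_sq_le hadp hX m)

end Maximal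

/-! ### The exact system over a short time -/

section Exp

attribute [local instance] Matrix.linftyOpNormedRing Matrix.linftyOpNormedAlgebra

theorem hasDerivAt_matrix_exp_apply {α : Type*} [Fintype α] [DecidableEq α] (A : Matrix α α ℝ)
    (a b : α) : HasDerivAt (fun t : ℝ => NormedSpace.exp (t • A) a b) (A a b) 0 := by
  have h := hasDerivAt_exp_smul_const A (0 : ℝ)
  rw [zero_smul, NormedSpace.exp_zero, one_mul] at h
  exact ((Matrix.entryLinearMap ℝ ℝ a b).toContinuousLinearMap.hasFDerivAt).comp_hasDerivAt 0 h

end Exp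

/-- Finiteness makes the first-order expansion uniform; the index `ι` will be the finite set of
graphs. -/
theorem eventually_abs_matrix_exp_sub_le {ι α : Type*} [Finite ι] [Fintype α] [DecidableEq α]
    (A : ι → Matrix α α ℝ) {κ : ℝ} (hκ : 0 < κ) :
    ∀ᶠ t : ℝ in 𝓝[>] 0, ∀ i a b,
      |NormedSpace.exp (t • A i) a b - ((1 : Matrix α α ℝ) a b + t * A i a b)| ≤ κ * t := by
  simp only [eventually_all]
  intro i a b
  have h := (hasDerivAt_iff_isLittleO.1 (hasDerivAt_matrix_exp_apply (A i) a b)).bound hκ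
  filter_upwards [nhdsWithin_le_nhds h, self_mem_nhdsWithin] with t ht ht0
  rw [zero_smul, NormedSpace.exp_zero, sub_zero, smul_eq_mul, Real.norm_eq_abs,
    Real.norm_of_nonneg (le_of_lt ht0), sub_sub] at ht
  exact ht

/-- Since `f` vanishes at the current configuration, the diagonal of the generator does not
contribute. -/
theorem sum_mul_generator {N S : ℕ} (p : ℝ) (q : Fin S → Fin S → (Fin S → ℝ) → ℝ)
    (g : SimpleGraph (Fin N)) (c : Config N S) {f : Config N S → ℝ} (hf : f c = 0) :
    ∑ c', f c' * generator p q g c c' = ∑ i, ∑ k ∈ Finset.univ.erase (c i),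
      f (Function.update c i k) * q k (c i) (environment p g (indicators c) i) := by
  have h1 : ∀ c', f c' * generator p q g c c' = f c' * jumpRate p q g c c' := by
    intro c'
    by_cases h : c = c'
    · subst h; simp [hf]
    · simp [generator, Matrix.diagonal_apply_ne _ h]
  simp_rw [h1, jumpRate, Finset.mul_sum]
  rw [Finset.sum_comm]
  refine Finset.sum_congr rfl fun i _ => ?_
  rw [Finset.sum_comm]
  refine Finset.sum_congr rfl fun k _ => ?_
  simp

theorem abs_sum_mul_exp_generator_sub_le {N S : ℕ} {p : ℝ}
    {q : Fin S → Fin S → (Fin S → ℝ) → ℝ} {g : SimpleGraph (Fin N)} {c : Config N S}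
    {κ t : ℝ} (hexp : ∀ c', |NormedSpace.exp (t • generator p q g) c c' -
      ((1 : Matrix (Config N S) (Config N S) ℝ) c c' + t * generator p q g c c')| ≤ κ * t)
    {f : Config N S → ℝ} (hf : f c = 0) (hf1 : ∀ c', |f c'| ≤ 1) :
    |∑ c', f c' * NormedSpace.exp (t • generator p q g) c c' -
      t * ∑ i, ∑ k ∈ Finset.univ.erase (c i),
        f (Function.update c i k) * q k (c i) (environment p g (indicators c) i)| ≤
      Fintype.card (Config N S) * (κ * t) := by
  rw [← sum_mul_generator p q g c hf, Finset.mul_sum, ← Finset.sum_sub_distrib]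
  refine (Finset.abs_sum_le_sum_abs _ _).trans ?_
  calc _ ≤ ∑ _c' : Config N S, κ * t := Finset.sum_le_sum fun c' _ => ?_
    _ = _ := by simp
  have h1 : f c' * (1 : Matrix (Config N S) (Config N S) ℝ) c c' = 0 := by
    by_cases h : c = c'
    · subst h; simp [hf]
    · simp [h]
  have h2 : f c' * NormedSpace.exp (t • generator p q g) c c' - t * (f c' * generator p q g c c') =
      f c' * (NormedSpace.exp (t • generator p q g) c c' -
      ((1 : Matrix (Config N S) (Config N S) ℝ) c c' + t * generator p q g c c')) := by
    linear_combination h1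
  rw [h2, abs_mul]
  exact (mul_le_of_le_one_left (abs_nonneg _) (hf1 c')).trans (hexp c')

theorem indicators_mem_stdSimplex {N S : ℕ} (c : Config N S) (i : Fin N) :
    indicators c i ∈ stdSimplex ℝ (Fin S) :=
  single_mem_stdSimplex ℝ (c i)

theorem average_indicators_update_sub {N S : ℕ} (c : Config N S) (i : Fin N) (k l : Fin S) :
    average (indicators (Function.update c i k)) l - average (indicators c) l =
      1 / (N : ℝ) * ((if l = k then 1 else 0) - if l = c i then 1 else 0) := by
  rw [average_apply, average_apply, ← mul_sub, ← Finset.sum_sub_distrib,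
    Finset.sum_eq_single i]
  · simp [indicators, Pi.single_apply]
  · intro j _ hj
    simp [indicators, Function.update_of_ne hj]
  · simp

/-- A jump of vertex `i` moves the average by `(e_k - e_{c i}) / N`; weighted by the rates, these
vectors add up to the column `c i` of the rate matrix. -/
theorem sum_jump_average {N S : ℕ} (p : ℝ) (q : Fin S → Fin S → (Fin S → ℝ) → ℝ)
    (g : SimpleGraph (Fin N)) (c : Config N S) (l : Fin S) :
    ∑ i, ∑ k ∈ Finset.univ.erase (c i),
      (average (indicators (Function.update c i k)) l - average (indicators c) l) *
        q k (c i) (environment p g (indicators c) i) =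
      average (fun i => rateMatrix q (environment p g (indicators c) i) *ᵥ indicators c i) l := by
  simp only [average_indicators_update_sub, mul_assoc]
  rw [average_apply, Finset.mul_sum]
  refine Finset.sum_congr rfl fun i _ => ?_
  rw [← Finset.mul_sum (Finset.univ.erase (c i))]
  congr 1
  rw [indicators, Matrix.mulVec_single_one]
  simp only [Matrix.col_apply, rateMatrix, Matrix.of_apply]
  by_cases h : l = c i
  · subst h
    simp only [if_true]
    rw [← Finset.sum_neg_distrib]
    refine Finset.sum_congr rfl fun k hk => ?_
    rw [if_neg (Finset.ne_of_mem_erase hk).symm]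
    ring
  · simp only [if_neg h, sub_zero, ite_mul, one_mul, zero_mul]
    rw [Finset.sum_ite_eq, if_pos (by simpa using h)]

/-- Squared jumps of each coordinate are at most `1 / N²`, and there are at most `N S` transitions,
each of rate at most `K`. -/
theorem sum_jump_average_sq_le {N S : ℕ} (hN : 2 ≤ N) {p K : ℝ} (hp : 0 < p)
    {q : Fin S → Fin S → (Fin S → ℝ) → ℝ} (hK : RateBound q (2 / p) K)
    (g : SimpleGraph (Fin N)) (c : Config N S) (l : Fin S) :
    ∑ i, ∑ k ∈ Finset.univ.erase (c i),
      (average (indicators (Function.update c i k)) l - average (indicators c) l) ^ 2 *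
        q k (c i) (environment p g (indicators c) i) ≤ S * K / N := by
  have hN0 : (N : ℝ) ≠ 0 := by exact_mod_cast (by omega : N ≠ 0)
  have hK0 := hK.nonneg
  calc _ ≤ ∑ _i : Fin N, ∑ _k : Fin S, (1 / (N : ℝ)) ^ 2 * K := by
        refine Finset.sum_le_sum fun i _ => ?_
        refine le_trans (Finset.sum_le_sum fun k hk => ?_)
          (Finset.sum_le_sum_of_subset_of_nonneg (Finset.erase_subset (c i) _)
            fun _ _ _ => by positivity)
        rw [average_indicators_update_sub, mul_pow, mul_assoc]
        refine mul_le_mul_of_nonneg_left ?_ (by positivity)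
        have hq : |q k (c i) (environment p g (indicators c) i)| ≤ K :=
          hK.rate_le k (c i) (Finset.ne_of_mem_erase hk) _
            (norm_environment_le hN hp g (indicators_mem_stdSimplex c) i)
        have hd : ((if l = k then (1 : ℝ) else 0) - if l = c i then 1 else 0) ^ 2 ≤ 1 := by
          split_ifs <;> norm_num
        refine (le_abs_self _).trans ?_
        rw [abs_mul, abs_of_nonneg (sq_nonneg _)]
        exact (mul_le_of_le_one_left (abs_nonneg _) hd).trans hq
    _ = S * K / N := by
        simp only [Finset.sum_const, Finset.card_univ, Fintype.card_fin, nsmul_eq_mul]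
        field_simp


/-! ### The Markov property -/

section Markov

variable {Ω : Type*} {N S : ℕ} {G : Ω → SimpleGraph (Fin N)} {σ : ℝ → Ω → Config N S}

theorem past_mono {s t : ℝ} (hst : s ≤ t) : past G σ s ≤ past G σ t :=
  sup_le_sup_left (biSup_mono fun _ hr => ⟨hr.1, hr.2.trans hst⟩) _

theorem measurable_process_past {r s : ℝ} (hr : r ∈ Set.Icc 0 s) :
    Measurable[past G σ s] (σ r) :=
  (comap_measurable (σ r)).mono
    ((le_biSup (fun r => MeasurableSpace.comap (σ r) inferInstance) hr).trans le_sup_right) le_rfl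

variable [mΩ : MeasurableSpace Ω] {p : ℝ} {q : Fin S → Fin S → (Fin S → ℝ) → ℝ} {P : Measure Ω}

theorem IsExactSystem.past_le (hσ : IsExactSystem p q P G σ) (s : ℝ) : past G σ s ≤ mΩ :=
  sup_le hσ.measurable_graph.comap_le
    (iSup₂_le fun r hr => (hσ.measurable_process r hr.1).comap_le)

theorem integrable_comp_of_finite [IsFiniteMeasure P] {α : Type*} [Finite α] [MeasurableSpace α]
    [MeasurableSingletonClass α] {Z : Ω → α} (hZ : Measurable Z) (f : α → ℝ) :
    Integrable (fun ω => f (Z ω)) P :=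
  (Integrable.of_finite (f := f) (μ := P.map Z)).comp_measurable hZ

/-- Decomposing over the finitely many final configurations, each coefficient `f (σ s) c` is known
at time `s` and leaves the conditional expectation. -/
theorem IsExactSystem.condExp_transition [IsProbabilityMeasure P]
    (hσ : IsExactSystem p q P G σ) {s t : ℝ} (hs : 0 ≤ s) (ht : 0 ≤ t)
    (f : Config N S → Config N S → ℝ) :
    P[fun ω => f (σ s ω) (σ (s + t) ω) | past G σ s] =ᵐ[P]
      fun ω => ∑ c, f (σ s ω) c * NormedSpace.exp (t • generator p q (G ω)) (σ s ω) c := by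
  have hσs := hσ.measurable_process s hs
  have hσt := hσ.measurable_process (s + t) (add_nonneg hs ht)
  have hdec : (fun ω => f (σ s ω) (σ (s + t) ω)) = ∑ c,
      (fun ω => f (σ s ω) c) * fun ω => if σ (s + t) ω = c then (1 : ℝ) else 0 := by
    ext ω
    simp [Finset.sum_apply]
  have hI : ∀ c, Integrable (fun ω => if σ (s + t) ω = c then (1 : ℝ) else 0) P := fun c =>
    integrable_comp_of_finite hσt fun c' => if c' = c then (1 : ℝ) else 0
  have hfI : ∀ c, Integrable ((fun ω => f (σ s ω) c) *
      fun ω => if σ (s + t) ω = c then (1 : ℝ) else 0) P := fun c =>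
    integrable_comp_of_finite (hσs.prodMk hσt)
      fun x => f x.1 c * if x.2 = c then (1 : ℝ) else 0
  have hfm : ∀ c, StronglyMeasurable[past G σ s] fun ω => f (σ s ω) c := fun c =>
    ((Measurable.of_discrete (f := fun c' => f c' c)).comp
      (measurable_process_past (G := G) ⟨hs, le_rfl⟩)).stronglyMeasurable
  rw [hdec]
  refine (condExp_finsetSum (fun c _ => hfI c) _).trans ?_
  have hc : ∀ c, P[(fun ω => f (σ s ω) c) * fun ω => if σ (s + t) ω = c then (1 : ℝ) else 0 |
      past G σ s] =ᵐ[P]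
        fun ω => f (σ s ω) c * NormedSpace.exp (t • generator p q (G ω)) (σ s ω) c := by
    intro c
    refine (condExp_mul_of_stronglyMeasurable_left (hfm c) (hfI c) (hI c)).trans ?_
    filter_upwards [hσ.markov s t hs ht c] with ω hω
    rw [Pi.mul_apply, hω]
  filter_upwards [eventually_all.2 hc] with ω hω
  rw [Finset.sum_apply]
  exact Finset.sum_congr rfl fun c _ => hω c

/-- For small `t`, over any time interval of length `t`, the fraction of vertices in the state `l`
has conditional drift close to the average of the drifts of the vertices, and its increment has
second moment of order `t / N`. -/
theorem IsExactSystem.eventually_increment [IsProbabilityMeasure P]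
    (hσ : IsExactSystem p q P G σ) (hN : 2 ≤ N) (hp : 0 < p) {K : ℝ}
    (hK : RateBound q (2 / p) K) {κ : ℝ} (hκ : 0 < κ) :
    ∀ᶠ t : ℝ in 𝓝[>] 0, ∀ s, 0 ≤ s → ∀ l : Fin S,
      (∀ᵐ ω ∂P, |(P[(fun ω => average (indicators (σ (s + t) ω)) l) -
          (fun ω => average (indicators (σ s ω)) l) | past G σ s]) ω -
        t * average (fun i => rateMatrix q (environment p (G ω) (indicators (σ s ω)) i) *ᵥ
          indicators (σ s ω) i) l| ≤ κ * t) ∧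
      ∫ ω, (average (indicators (σ (s + t) ω)) l - average (indicators (σ s ω)) l) ^ 2 ∂P ≤
        (S * K / N + κ) * t := by
  set m : ℝ := ((Fintype.card (Config N S) : ℕ) : ℝ)
  -- The expansion error is summed over all `m` configurations. This number is exponential in `N`,
  -- but `N` is fixed while `t → 0`.
  have hκ' : 0 < κ / (m + 1) := by positivity
  have hm : ∀ t : ℝ, 0 ≤ t → m * (κ / (m + 1) * t) ≤ κ * t := by
    intro t ht
    rw [← mul_assoc]
    refine mul_le_mul_of_nonneg_right ?_ ht
    rw [← mul_div_assoc, div_le_iff₀ (by positivity)]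
    nlinarith
  have habs : ∀ c c' : Config N S, ∀ l,
      |average (indicators c') l - average (indicators c) l| ≤ 1 := by
    intro c c' l
    have h : ∀ c : Config N S, 0 ≤ average (indicators c) l ∧ average (indicators c) l ≤ 1 :=
      fun c => by
        have hmem := average_mem_stdSimplex (by omega) (indicators_mem_stdSimplex c)
        exact ⟨hmem.1 l, (le_abs_self _).trans ((norm_le_pi_norm _ l).trans
          (norm_le_one_of_mem_stdSimplex hmem))⟩
    rw [abs_le]
    constructor <;> linarith [(h c).1, (h c).2, (h c').1, (h c').2]
  filter_upwards [eventually_abs_matrix_exp_sub_le (generator (N := N) (S := S) p q) hκ',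
    self_mem_nhdsWithin] with t hexp ht0 s hs l
  have ht : 0 ≤ t := le_of_lt ht0
  constructor
  · filter_upwards [hσ.condExp_transition hs ht
      fun c c' => average (indicators c') l - average (indicators c) l] with ω hω
    change |(P[fun ω => average (indicators (σ (s + t) ω)) l -
      average (indicators (σ s ω)) l | past G σ s]) ω - _| ≤ _
    rw [hω, ← sum_jump_average]
    exact (abs_sum_mul_exp_generator_sub_le (hexp (G ω) (σ s ω))
      (f := fun c' => average (indicators c') l - average (indicators (σ s ω)) l) (sub_self _)
      fun c' => habs _ c' l).trans (hm t ht)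
  · have hpt : ∀ ω, ∑ c, (average (indicators c) l - average (indicators (σ s ω)) l) ^ 2 *
        NormedSpace.exp (t • generator p q (G ω)) (σ s ω) c ≤ (S * K / N + κ) * t := by
      intro ω
      have h1 := abs_sum_mul_exp_generator_sub_le (hexp (G ω) (σ s ω))
        (f := fun c' => (average (indicators c') l - average (indicators (σ s ω)) l) ^ 2)
        (by simp) fun c' => by
          rw [abs_pow]; exact pow_le_one₀ (abs_nonneg _) (habs _ c' l)
      have h2 := (abs_le.1 h1).2
      have h3 := sum_jump_average_sq_le hN hp hK (G ω) (σ s ω) l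
      have h4 := mul_le_mul_of_nonneg_left h3 ht
      have h5 := hm t ht
      beta_reduce at h2
      linarith
    rw [← integral_condExp (hσ.past_le s)]
    refine (integral_mono_ae integrable_condExp (integrable_const ((S * K / N + κ) * t))
      ?_).trans_eq (by simp)
    filter_upwards [hσ.condExp_transition hs ht
      fun c c' => (average (indicators c') l - average (indicators c) l) ^ 2] with ω hω
    rw [hω]
    exact hpt ω

end Markov

/-! ### Comparison along a grid -/

theorem le_mul_one_add_pow_of_le_sum {e : ℕ → ℝ} {A b : ℝ} {m : ℕ} (hb : 0 ≤ b)
    (he : ∀ k ≤ m, e k ≤ A + b * ∑ j ∈ Finset.range k, e j) {k : ℕ} (hk : k ≤ m) :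
    e k ≤ A * (1 + b) ^ k := by
  induction k using Nat.strong_induction_on with
  | _ k ih =>
    refine (he k hk).trans ?_
    have h1 : ∑ j ∈ Finset.range k, e j ≤ ∑ j ∈ Finset.range k, A * (1 + b) ^ j :=
      Finset.sum_le_sum fun j hj =>
        ih j (Finset.mem_range.1 hj) ((Finset.mem_range.1 hj).le.trans hk)
    have h2 : A + b * ∑ j ∈ Finset.range k, A * (1 + b) ^ j = A * (1 + b) ^ k := by
      have := mul_geom_sum (1 + b) k
      rw [← Finset.mul_sum]
      rw [add_sub_cancel_left] at this
      linear_combination A * this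
    exact (add_le_add le_rfl (mul_le_mul_of_nonneg_left h1 hb)).trans h2.le

/-- A discrete Grönwall comparison of two perturbed Euler schemes. -/
theorem norm_sub_le_of_approx_euler {E : Type*} [NormedAddCommGroup E] [NormedSpace ℝ E]
    {x u B C : ℕ → E} {h a r r' d L : ℝ} {m : ℕ} (hh : 0 ≤ h) (hL : 0 ≤ L) (hd : 0 ≤ d)
    (hr : 0 ≤ r) (hr' : 0 ≤ r') (h0 : ‖x 0 - u 0‖ ≤ a)
    (hx : ∀ k ≤ m, ‖x k - x 0 - ∑ j ∈ Finset.range k, h • B j‖ ≤ r)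
    (hu : ∀ k ≤ m, ‖u k - u 0 - ∑ j ∈ Finset.range k, h • C j‖ ≤ r')
    (hBC : ∀ j ≤ m, ‖B j - C j‖ ≤ L * ‖x j - u j‖ + d) {k : ℕ} (hk : k ≤ m) :
    ‖x k - u k‖ ≤ (a + r + r' + m * h * d) * Real.exp (L * (m * h)) := by
  have ha : 0 ≤ a := (norm_nonneg _).trans h0
  have key : ∀ k ≤ m, ‖x k - u k‖ ≤ (a + r + r' + m * h * d) +
      h * L * ∑ j ∈ Finset.range k, ‖x j - u j‖ := by
    intro k hk
    have hdec : x k - u k = (x 0 - u 0) + (x k - x 0 - ∑ j ∈ Finset.range k, h • B j) -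
        (u k - u 0 - ∑ j ∈ Finset.range k, h • C j) + ∑ j ∈ Finset.range k, h • (B j - C j) := by
      simp only [smul_sub, Finset.sum_sub_distrib]
      abel
    have hsum : ‖∑ j ∈ Finset.range k, h • (B j - C j)‖ ≤
        h * L * ∑ j ∈ Finset.range k, ‖x j - u j‖ + m * h * d := by
      calc _ ≤ ∑ j ∈ Finset.range k, (h * L * ‖x j - u j‖ + h * d) := by
            refine (norm_sum_le _ _).trans (Finset.sum_le_sum fun j hj => ?_)
            rw [norm_smul, Real.norm_of_nonneg hh, mul_assoc, ← mul_add]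
            exact mul_le_mul_of_nonneg_left
              (hBC j ((Finset.mem_range.1 hj).le.trans hk)) hh
        _ = h * L * ∑ j ∈ Finset.range k, ‖x j - u j‖ + k * h * d := by
            rw [Finset.sum_add_distrib, Finset.mul_sum]; simp; ring
        _ ≤ _ := by gcongr
    rw [hdec]
    refine (norm_add_le _ _).trans ?_
    refine (add_le_add ((norm_sub_le _ _).trans
      (add_le_add (norm_add_le _ _) (hu k hk))) hsum).trans ?_
    linarith [hx k hk]
  refine (le_mul_one_add_pow_of_le_sum (by positivity) key hk).trans ?_
  refine mul_le_mul_of_nonneg_left ?_ (by positivity)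
  calc (1 + h * L) ^ k ≤ Real.exp (h * L) ^ k := by
        gcongr
        linarith [Real.add_one_le_exp (h * L)]
    _ = Real.exp (k * (h * L)) := (Real.exp_nat_mul _ _).symm
    _ ≤ Real.exp (L * (m * h)) := by
        refine Real.exp_le_exp.2 ?_
        have : (k : ℝ) * (h * L) ≤ m * (h * L) := by gcongr
        linarith

/-- The local error of the Euler scheme: `u` is `K`-Lipschitz in time and the drift `2K`-Lipschitz
on the simplex, so the remainder has derivative at most `2K²h`. -/
theorem IsMeanFieldSolution.norm_step_sub_le {S : ℕ} {q : Fin S → Fin S → (Fin S → ℝ) → ℝ}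
    (hq_lip : ∀ k s, k ≠ s → LocallyLipschitz (q k s))
    (hq_nonneg : ∀ k s, k ≠ s → ∀ φ : Fin S → ℝ, (∀ l, 0 ≤ φ l) → 0 ≤ q k s φ)
    {R K : ℝ} (hK : RateBound q R K) (hR : 1 ≤ R) {u : ℝ → Fin S → ℝ}
    (hu : IsMeanFieldSolution q u) {t h : ℝ} (ht : 0 ≤ t) (hh : 0 ≤ h) :
    ‖u (t + h) - u t - h • (rateMatrix q (u t) *ᵥ u t)‖ ≤ 2 * K ^ 2 * h * h := by
  have hK0 := hK.nonneg
  have hmem : ∀ r, 0 ≤ r → u r ∈ stdSimplex ℝ (Fin S) := fun r hr =>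
    hu.mem_stdSimplex hq_lip hq_nonneg hr
  have hder : ∀ r ∈ Set.Icc t (t + h), HasDerivWithinAt u (rateMatrix q (u r) *ᵥ u r)
      (Set.Icc t (t + h)) r := fun r hr =>
    (hu.2 r (ht.trans hr.1)).mono fun y hy => ht.trans hy.1
  have hLip : ∀ r ∈ Set.Icc t (t + h), ‖u r - u t‖ ≤ K * (r - t) :=
    norm_image_sub_le_of_norm_deriv_le_segment' hder fun r hr => by
      have h1 := norm_le_one_of_mem_stdSimplex (hmem r (ht.trans hr.1))
      exact (hK.norm_mulVec_le _ _ (h1.trans hR)).trans (mul_le_of_le_one_right hK0 h1)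
  have hder2 : ∀ r ∈ Set.Icc t (t + h),
      HasDerivWithinAt (fun r => u r - (r - t) • (rateMatrix q (u t) *ᵥ u t))
        (rateMatrix q (u r) *ᵥ u r - (1 : ℝ) • (rateMatrix q (u t) *ᵥ u t))
        (Set.Icc t (t + h)) r := fun r hr =>
    (hder r hr).sub (((hasDerivWithinAt_id r _).sub_const t).smul_const _)
  have := norm_image_sub_le_of_norm_deriv_le_segment' hder2 (C := 2 * K ^ 2 * h)
    (fun r hr => by
      rw [one_smul]
      refine (hK.norm_drift_sub_le hR (hmem r (ht.trans hr.1)) (hmem t ht)).trans ?_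
      calc 2 * K * ‖u r - u t‖ ≤ 2 * K * (K * h) := by
            gcongr
            refine (hLip r ⟨hr.1, hr.2.le⟩).trans ?_
            gcongr
            linarith [hr.2]
        _ = _ := by ring) (t + h) ⟨by linarith, le_rfl⟩
  rw [sub_self, zero_smul, sub_zero, add_sub_cancel_left] at this
  rwa [sub_right_comm]

section Grid

variable {Ω : Type*} [mΩ : MeasurableSpace Ω] {N S : ℕ} {p : ℝ}
  {q : Fin S → Fin S → (Fin S → ℝ) → ℝ} {P : Measure Ω} [IsProbabilityMeasure P]
  {G : Ω → SimpleGraph (Fin N)} {σ : ℝ → Ω → Config N S}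

/-- The filtration generated by the graph and the process, along the grid of step `h`. -/
def IsExactSystem.gridFiltration (hσ : IsExactSystem p q P G σ) {h : ℝ} (hh : 0 ≤ h) :
    Filtration ℕ mΩ where
  seq k := past G σ (k * h)
  mono' _ _ hij := past_mono (mul_le_mul_of_nonneg_right (Nat.cast_le.2 hij) hh)
  le' k := hσ.past_le (k * h)

/-- On the grid of step `h`, the average of the exact system is, with high probability, uniformly
close to the mean-field solution. -/
theorem IsExactSystem.measure_grid_le (hσ : IsExactSystem p q P G σ) (hN : 2 ≤ N) (hp : 0 < p)
    (hp1 : p ≤ 1) (hq_lip : ∀ k s, k ≠ s → LocallyLipschitz (q k s))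
    (hq_nonneg : ∀ k s, k ≠ s → ∀ φ : Fin S → ℝ, (∀ l, 0 ≤ φ l) → 0 ≤ q k s φ)
    {K : ℝ} (hK : RateBound q (2 / p) K) {u : ℝ → Fin S → ℝ} (hu : IsMeanFieldSolution q u)
    {a κ h T : ℝ} (ha : 0 < a) (hh : 0 < h) {m : ℕ} (hmh : m * h = T) (hκ : 2 * K ^ 2 * h ≤ κ)
    (hκa : κ ≤ a)
    (hinc : ∀ s, 0 ≤ s → ∀ l : Fin S,
      (∀ᵐ ω ∂P, |(P[(fun ω => average (indicators (σ (s + h) ω)) l) -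
          (fun ω => average (indicators (σ s ω)) l) | past G σ s]) ω -
        h * average (fun i => rateMatrix q (environment p (G ω) (indicators (σ s ω)) i) *ᵥ
          indicators (σ s ω) i) l| ≤ κ * h) ∧
      ∫ ω, (average (indicators (σ (s + h) ω)) l - average (indicators (σ s ω)) l) ^ 2 ∂P ≤
        (S * K / N + κ) * h) :
    P {ω | ∃ k ≤ m, (2 + 2 * T + T * (K * S)) * Real.exp (2 * K * T) * a <
        ‖average (indicators (σ (k * h) ω)) - u (k * h)‖} ≤
      P {ω | ENNReal.ofReal a ≤ dist₁ (average (indicators (σ 0 ω))) (u 0)} +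
      P {ω | ¬ IsBalanced p (G ω) a} + S * ENNReal.ofReal (T * (S * K / N + κ) / a ^ 2) := by
  have hK0 := hK.nonneg
  have hR : 1 ≤ 2 / p := by rw [le_div_iff₀ hp]; linarith
  have hκ0 : 0 ≤ κ := le_trans (by positivity) hκ
  have hkh : ∀ k : ℕ, 0 ≤ (k : ℝ) * h := fun k => by positivity
  set ℱ := hσ.gridFiltration hh.le
  set X : Fin S → ℕ → Ω → ℝ := fun l k ω => average (indicators (σ (k * h) ω)) l with hX
  have hsucc : ∀ k : ℕ, ((k + 1 : ℕ) : ℝ) * h = k * h + h := fun k => by push_cast; ring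
  have hadp : ∀ l, StronglyAdapted ℱ (X l) := fun l k =>
    ((Measurable.of_discrete (f := fun c : Config N S => average (indicators c) l)).comp
      (measurable_process_past (G := G) ⟨hkh k, le_rfl⟩)).stronglyMeasurable
  have hX2 : ∀ l k, MemLp (X l k) 2 P := fun l k =>
    MemLp.of_bound ((hadp l k).mono (ℱ.le k)).aestronglyMeasurable 1
      (Eventually.of_forall fun ω => (norm_le_pi_norm _ l).trans (norm_le_one_of_mem_stdSimplex
        (average_mem_stdSimplex (by omega) (indicators_mem_stdSimplex _))))
  have hdrift : ∀ᵐ ω ∂P, ∀ (j : ℕ) (l : Fin S), |(P[X l (j + 1) - X l j | ℱ j]) ω -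
      h * average (fun i => rateMatrix q (environment p (G ω) (indicators (σ (j * h) ω)) i) *ᵥ
        indicators (σ (j * h) ω) i) l| ≤ κ * h := by
    refine ae_all_iff.2 fun j => ae_all_iff.2 fun l => ?_
    have := (hinc (j * h) (hkh j) l).1
    simp only [hX, hsucc]
    exact this
  -- A union bound over the coordinates, with Doob's inequality for each; the second moments of the
  -- `m` steps of length `h` add up to `T (S K / N + κ)`.
  have hmax : P {ω | ∃ l, ∃ k ≤ m, a ≤ |∑ j ∈ Finset.range k, innovation P ℱ (X l) j ω|} ≤
      S * ENNReal.ofReal (T * (S * K / N + κ) / a ^ 2) := by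
    rw [Set.ofPred_exists]
    refine (measure_iUnion_fintype_le _ _).trans ?_
    calc _ ≤ ∑ _l : Fin S, ENNReal.ofReal (T * (S * K / N + κ) / a ^ 2) := by
          refine Finset.sum_le_sum fun l _ => ?_
          refine (measure_exists_le_abs_sum_innovation (hadp l) (hX2 l) ha m).trans ?_
          refine ENNReal.ofReal_le_ofReal ?_
          gcongr
          calc _ ≤ ∑ _j ∈ Finset.range m, (S * K / N + κ) * h := by
                refine Finset.sum_le_sum fun j _ => ?_
                have := (hinc (j * h) (hkh j) l).2
                simp only [hX, hsucc]
                exact this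
            _ = T * (S * K / N + κ) := by
                rw [← hmh]; simp; ring
      _ = _ := by simp
  refine le_trans ?_ (add_le_add (measure_union_le _ _) hmax)
  refine le_trans (measure_mono_ae ?_) (measure_union_le _ _)
  filter_upwards [hdrift] with ω hω hlarge
  by_contra hcon
  have hinit : dist₁ (average (indicators (σ 0 ω))) (u 0) < ENNReal.ofReal a :=
    not_le.1 fun h => hcon (Or.inl (Or.inl h))
  have hbal : IsBalanced p (G ω) a := by_contra fun h => hcon (Or.inl (Or.inr h))
  have hmart : ∀ l, ∀ k ≤ m, |∑ j ∈ Finset.range k, innovation P ℱ (X l) j ω| < a :=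
    fun l k hk => not_le.1 fun h => hcon (Or.inr ⟨l, k, hk, h⟩)
  obtain ⟨k, hk, hlt⟩ := hlarge
  refine absurd hlt (not_lt.2 ?_)
  have hTκ : ∀ k ≤ m, (k : ℝ) * (κ * h) ≤ T * κ := fun k hk => by
    rw [← hmh]
    have : (k : ℝ) * (κ * h) ≤ m * (κ * h) := by gcongr
    linarith
  have hT0 : 0 ≤ T := hmh ▸ hkh m
  -- The errors are: `a` from the innovations and `T κ` from the conditional drifts in `r`, `T κ`
  -- from the Euler steps of `u` in `r'`, and `K S a` from the imperfect balance of the graph in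
  -- `d`.
  have hfin := norm_sub_le_of_approx_euler (x := fun k : ℕ => average (indicators (σ (k * h) ω)))
    (u := fun k : ℕ => u (k * h))
    (B := fun k : ℕ => average fun i => rateMatrix q
      (environment p (G ω) (indicators (σ (k * h) ω)) i) *ᵥ indicators (σ (k * h) ω) i)
    (C := fun k : ℕ => rateMatrix q (u (k * h)) *ᵥ u (k * h)) (h := h) (a := a)
    (r := a + T * κ) (r' := T * κ) (d := K * S * a) (L := 2 * K) (m := m) hh.le (by positivity)
    (by positivity) (by positivity) (by positivity)
    (by
      simp only [Nat.cast_zero, zero_mul]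
      exact (norm_sub_lt_of_dist₁_lt hinit).le)
    (fun k hk => by
      refine (pi_norm_le_iff_of_nonneg (by positivity)).2 fun l => ?_
      have hdec : X l k ω - X l 0 ω = ∑ j ∈ Finset.range k, innovation P ℱ (X l) j ω +
          ∑ j ∈ Finset.range k, (P[X l (j + 1) - X l j | ℱ j]) ω := by
        rw [← Finset.sum_range_sub (fun j => X l j ω), ← Finset.sum_add_distrib]
        refine Finset.sum_congr rfl fun j _ => ?_
        simp [innovation]
      have heq : (average (indicators (σ (k * h) ω)) - average (indicators (σ ((0 : ℕ) * h) ω)) -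
          ∑ j ∈ Finset.range k, h • average fun i => rateMatrix q
            (environment p (G ω) (indicators (σ (j * h) ω)) i) *ᵥ indicators (σ (j * h) ω) i) l =
          ∑ j ∈ Finset.range k, innovation P ℱ (X l) j ω +
          ∑ j ∈ Finset.range k, ((P[X l (j + 1) - X l j | ℱ j]) ω - h * average (fun i =>
            rateMatrix q (environment p (G ω) (indicators (σ (j * h) ω)) i) *ᵥ
              indicators (σ (j * h) ω) i) l) := by
        rw [Finset.sum_sub_distrib, ← add_sub_assoc, ← hdec]
        simp [hX, Finset.sum_apply]
      rw [heq]
      refine (norm_add_le _ _).trans (add_le_add (hmart l k hk).le ?_)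
      refine (norm_sum_le _ _).trans ((Finset.sum_le_sum fun j _ => hω j l).trans ?_)
      simpa using hTκ k hk)
    (fun k hk => by
      rw [← Finset.sum_range_sub (fun j : ℕ => u (j * h)), ← Finset.sum_sub_distrib]
      refine (norm_sum_le _ _).trans ((Finset.sum_le_sum (g := fun _ => κ * h)
        fun j _ => ?_).trans ?_)
      · rw [hsucc]
        refine (hu.norm_step_sub_le hq_lip hq_nonneg hK hR (hkh j) hh.le).trans ?_
        gcongr
      · simpa using hTκ k hk)
    (fun j _ => by
      have hxm := average_mem_stdSimplex (by omega : 0 < N)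
        (indicators_mem_stdSimplex (σ (j * h) ω))
      have h1 := hbal.norm_average_drift_sub_le hN hp hp1 hK
        (indicators_mem_stdSimplex (σ (j * h) ω))
      have h2 := hK.norm_drift_sub_le hR hxm (hu.mem_stdSimplex hq_lip hq_nonneg (hkh j))
      refine (norm_sub_le_norm_sub_add_norm_sub _ _ _).trans ((add_le_add h1 h2).trans_eq ?_)
      ring) hk
  refine hfin.trans ?_
  rw [hmh, mul_right_comm _ (Real.exp _) a]
  refine mul_le_mul_of_nonneg_right ?_ (Real.exp_nonneg _)
  have : T * κ ≤ T * a := by gcongr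
  linarith

end Grid

/-! ### Convergence of the exact system -/

/-- Rounding down and adding one step approaches `t` strictly from the right, as right-continuity
requires; `t < T` keeps the point on the grid. -/
theorem exists_dyadic_tendsto {t T : ℝ} (ht : 0 ≤ t) (htT : t < T) :
    ∃ k : ℕ → ℕ, (∀ n, k n ≤ 2 ^ n) ∧
      Tendsto (fun n => (k n : ℝ) * (T / 2 ^ n)) atTop (𝓝[>] t) := by
  have hT : 0 < T := ht.trans_lt htT
  refine ⟨fun n => ⌊t / (T / 2 ^ n)⌋₊ + 1, fun n => ?_, tendsto_nhdsWithin_iff.2 ⟨?_, ?_⟩⟩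
  · refine Nat.succ_le_of_lt ((Nat.floor_lt (by positivity)).2 ?_)
    rw [div_lt_iff₀ (by positivity)]
    push_cast
    rwa [mul_div_cancel₀ T (by positivity)]
  · have hlim : Tendsto (fun n : ℕ => t + T / 2 ^ n) atTop (𝓝 t) := by
      have : Tendsto (fun n : ℕ => T / (2 : ℝ) ^ n) atTop (𝓝 0) :=
        tendsto_const_nhds.div_atTop (tendsto_pow_atTop_atTop_of_one_lt one_lt_two)
      simpa using tendsto_const_nhds.add this
    refine tendsto_of_tendsto_of_tendsto_of_le_of_le tendsto_const_nhds hlim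
      (fun n => ?_) fun n => ?_
    · have h := Nat.lt_floor_add_one (t / (T / 2 ^ n))
      rw [div_lt_iff₀ (by positivity)] at h
      push_cast
      exact h.le
    · have h := Nat.floor_le (a := t / (T / 2 ^ n)) (by positivity)
      rw [le_div_iff₀ (by positivity)] at h
      push_cast
      linarith
  · refine Eventually.of_forall fun n => ?_
    have h := Nat.lt_floor_add_one (t / (T / 2 ^ n))
    rw [div_lt_iff₀ (by positivity)] at h
    push_cast
    exact h

theorem norm_sub_le_of_forall_dyadic {N S : ℕ} {σ : ℝ → Config N S} {u : ℝ → Fin S → ℝ}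
    {C T : ℝ} (hσ : ∀ t, 0 ≤ t → ∀ᶠ r in 𝓝[>] t, σ r = σ t)
    (hu : ContinuousOn u (Set.Ici 0))
    (h : ∀ n : ℕ, ∀ k : ℕ, k ≤ 2 ^ n →
      ‖average (indicators (σ (k * (T / 2 ^ n)))) - u (k * (T / 2 ^ n))‖ ≤ C)
    {t : ℝ} (ht : t ∈ Set.Icc 0 T) : ‖average (indicators (σ t)) - u t‖ ≤ C := by
  rcases ht.2.lt_or_eq with htT | rfl
  · obtain ⟨k, hk, hlim⟩ := exists_dyadic_tendsto ht.1 htT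
    have hut : Tendsto u (𝓝[>] t) (𝓝 (u t)) :=
      (hu t ht.1).mono fun r hr => ht.1.trans (le_of_lt hr)
    refine le_of_tendsto ((tendsto_const_nhds (x := average (indicators (σ t)))).sub
      (hut.comp hlim)).norm ?_
    filter_upwards [hlim.eventually (hσ t ht.1)] with n hn
    have := h n (k n) (hk n)
    rwa [hn] at this
  -- The endpoint `T` cannot be approached from the right within the grid, but is itself a grid
  -- point.
  · simpa using h 0 1 le_rfl

/-- At a fixed size, the uniform distance between the average of the exact system and the
mean-field solution is small with high probability. -/
theorem IsExactSystem.measure_iSup_le {Ω : Type*} [MeasurableSpace Ω] {N S : ℕ} {p : ℝ}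
    {q : Fin S → Fin S → (Fin S → ℝ) → ℝ} {P : Measure Ω} [IsProbabilityMeasure P]
    {G : Ω → SimpleGraph (Fin N)} {σ : ℝ → Ω → Config N S}
    (hσ : IsExactSystem p q P G σ) (hN : 2 ≤ N) (hp : 0 < p)
    (hp1 : p ≤ 1) (hq_lip : ∀ k s, k ≠ s → LocallyLipschitz (q k s))
    (hq_nonneg : ∀ k s, k ≠ s → ∀ φ : Fin S → ℝ, (∀ l, 0 ≤ φ l) → 0 ≤ q k s φ)
    {K : ℝ} (hK : RateBound q (2 / p) K) {u : ℝ → Fin S → ℝ} (hu : IsMeanFieldSolution q u)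
    {a κ T ε : ℝ} (hT : 0 < T) (ha : 0 < a) (hκ : 0 < κ) (hκa : κ ≤ a) (hε : 0 < ε)
    (haε : S * ((2 + 2 * T + T * (K * S)) * Real.exp (2 * K * T)) * a < ε) :
    P {ω | ENNReal.ofReal ε ≤ ⨆ t ∈ Set.Icc (0 : ℝ) T,
        dist₁ (average (indicators (σ t ω))) (u t)} ≤
      P {ω | ENNReal.ofReal a ≤ dist₁ (average (indicators (σ 0 ω))) (u 0)} +
      P {ω | ¬ IsBalanced p (G ω) a} + S * ENNReal.ofReal (T * (S * K / N + κ) / a ^ 2) := by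
  set C : ℝ := (2 + 2 * T + T * (K * S)) * Real.exp (2 * K * T) * a with hC
  set E : ℕ → Set Ω := fun n => {ω | ∃ k : ℕ, k ≤ 2 ^ n ∧
    C < ‖average (indicators (σ (k * (T / 2 ^ n)) ω)) - u (k * (T / 2 ^ n))‖}
  -- Dyadic grids are nested, so the exceptional events increase. Their bound does not depend on `n`
  -- and passes to the union by continuity from below.
  have hmono : Monotone E := by
    refine monotone_nat_of_le_succ fun n => ?_
    rintro ω ⟨k, hk, hlt⟩
    refine ⟨2 * k, by rw [pow_succ]; omega, ?_⟩
    have : ((2 * k : ℕ) : ℝ) * (T / 2 ^ (n + 1)) = k * (T / 2 ^ n) := by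
      push_cast
      field_simp
      ring
    rwa [this]
  have hu_cont : ContinuousOn u (Set.Ici 0) := fun t ht => (hu.2 t ht).continuousWithinAt
  have hsub : P {ω | ENNReal.ofReal ε ≤ ⨆ t ∈ Set.Icc (0 : ℝ) T,
      dist₁ (average (indicators (σ t ω))) (u t)} ≤ P (⋃ n, E n) := by
    refine measure_mono_ae ?_
    filter_upwards [hσ.right_continuous] with ω hω hlarge
    by_contra hcon
    have hle : ∀ n : ℕ, ∀ k : ℕ, k ≤ 2 ^ n →
        ‖average (indicators (σ (k * (T / 2 ^ n)) ω)) - u (k * (T / 2 ^ n))‖ ≤ C :=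
      fun n k hk => not_lt.1 fun h => hcon (Set.mem_iUnion.2 ⟨n, k, hk, h⟩)
    refine absurd (show ENNReal.ofReal ε ≤ _ from hlarge) (not_le.2 ?_)
    refine lt_of_le_of_lt (iSup₂_le fun t ht => ?_) ((ENNReal.ofReal_lt_ofReal_iff hε).2 haε)
    refine (dist₁_le_of_norm_sub_le
      (norm_sub_le_of_forall_dyadic (σ := fun t => σ t ω) hω hu_cont hle ht)).trans ?_
    rw [hC, mul_assoc (S : ℝ)]
  refine hsub.trans ?_
  have hstep : Tendsto (fun n : ℕ => T / (2 : ℝ) ^ n) atTop (𝓝[>] 0) :=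
    tendsto_nhdsWithin_iff.2 ⟨tendsto_const_nhds.div_atTop
      (tendsto_pow_atTop_atTop_of_one_lt one_lt_two),
      Eventually.of_forall fun n => Set.mem_Ioi.2 (by positivity)⟩
  have hsmall : ∀ᶠ h : ℝ in 𝓝[>] 0, 2 * K ^ 2 * h ≤ κ := by
    have : Tendsto (fun h : ℝ => 2 * K ^ 2 * h) (𝓝[>] 0) (𝓝 0) := by
      have : Tendsto (fun h : ℝ => 2 * K ^ 2 * h) (𝓝 0) (𝓝 (2 * K ^ 2 * 0)) :=
        (continuous_const.mul continuous_id).tendsto 0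
      rw [mul_zero] at this
      exact this.mono_left nhdsWithin_le_nhds
    exact this.eventually_le_const hκ
  refine le_of_tendsto (tendsto_measure_iUnion_atTop hmono) ?_
  filter_upwards [hstep.eventually (hσ.eventually_increment hN hp hK hκ),
    hstep.eventually hsmall] with n hinc hn
  have := hσ.measure_grid_le hN hp hp1 hq_lip hq_nonneg hK hu (a := a) (κ := κ)
    (h := T / 2 ^ n) (T := T) (m := 2 ^ n) ha (by positivity)
    (by push_cast; exact mul_div_cancel₀ T (by positivity)) hn hκa hinc
  exact this

theorem tendstoZeroInProbability_exact {S : ℕ} {q : Fin S → Fin S → (Fin S → ℝ) → ℝ}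
    (hq_lip : ∀ k s, k ≠ s → LocallyLipschitz (q k s))
    (hq_nonneg : ∀ k s, k ≠ s → ∀ φ : Fin S → ℝ, (∀ l, 0 ≤ φ l) → 0 ≤ q k s φ)
    {p : unitInterval} (hp : 0 < p)
    {Ω : ℕ → Type*} [∀ N, MeasurableSpace (Ω N)] {P : ∀ N, Measure (Ω N)}
    [∀ N, IsProbabilityMeasure (P N)] {G : ∀ N, Ω N → SimpleGraph (Fin N)}
    (hG : ∀ N, HasLaw (G N) (SimpleGraph.binomialRandom (Fin N) p) (P N))
    {σ : ∀ N, ℝ → Ω N → Config N S} (hσ : ∀ N, IsExactSystem p q (P N) (G N) (σ N))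
    {u : ℝ → Fin S → ℝ} (hu : IsMeanFieldSolution q u)
    (h0 : TendstoZeroInProbability P
      (fun N ω => dist₁ (average (indicators (σ N 0 ω))) (u 0))) {T : ℝ} (hT : 0 < T) :
    TendstoZeroInProbability P (fun N ω =>
      ⨆ t ∈ Set.Icc (0 : ℝ) T, dist₁ (average (indicators (σ N t ω))) (u t)) := by
  have hp' : 0 < (p : ℝ) := hp
  obtain ⟨K, hK⟩ := exists_rateBound hq_lip (R := 2 / p)
  have hK0 := hK.nonneg
  refine tendstoZeroInProbability_of_real fun ε hε => ?_
  obtain ⟨a, ha, haε⟩ :=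
    exists_pos_mul_lt hε (S * ((2 + 2 * T + T * (K * S)) * Real.exp (2 * K * T)))
  have hlim3 : Tendsto (fun N : ℕ =>
      (S : ℝ≥0∞) * ENNReal.ofReal (T * (S * K + 1) / a ^ 2 / N)) atTop (𝓝 0) := by
    have h1 : Tendsto (fun N : ℕ => ENNReal.ofReal (T * (S * K + 1) / a ^ 2 / N)) atTop (𝓝 0) := by
      rw [← ENNReal.ofReal_zero]
      exact ENNReal.tendsto_ofReal (tendsto_const_div_atTop_nhds_zero_nat _)
    simpa using ENNReal.Tendsto.const_mul h1 (Or.inr (ENNReal.natCast_ne_top S))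
  have hlim := ((h0 (ENNReal.ofReal a) (ENNReal.ofReal_pos.2 ha)).add
    (tendsto_measure_not_isBalanced hp hG ha)).add hlim3
  rw [add_zero, add_zero] at hlim
  refine tendsto_of_tendsto_of_tendsto_of_le_of_le' tendsto_const_nhds hlim
    (Eventually.of_forall fun _ => zero_le) ?_
  filter_upwards [eventually_ge_atTop 2] with N hN
  have hN0 : (0 : ℝ) < N := by exact_mod_cast (by omega : 0 < N)
  -- The tolerance `κ` is free once the mesh has disappeared; `κ ≤ 1 / N` makes the fluctuation term
  -- `O(1 / N)`.
  refine ((hσ N).measure_iSup_le hN hp' p.2.2 hq_lip hq_nonneg hK hu (a := a)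
    (κ := min a (1 / N)) hT ha (lt_min ha (by positivity)) (min_le_left _ _) hε haε).trans ?_
  refine add_le_add le_rfl (mul_le_mul_right (ENNReal.ofReal_le_ofReal ?_) _)
  calc T * (S * K / N + min a (1 / N)) / a ^ 2 ≤ T * (S * K / N + 1 / N) / a ^ 2 := by
        gcongr
        exact min_le_right _ _
    _ = _ := by field_simp

end LocalDensity

theorem theorem1 {S : ℕ} (q : Fin S → Fin S → (Fin S → ℝ) → ℝ)
    (hq_lip : ∀ k s, k ≠ s → LocallyLipschitz (q k s))
    (hq_nonneg : ∀ k s, k ≠ s → ∀ φ : Fin S → ℝ, (∀ l, 0 ≤ φ l) → 0 ≤ q k s φ)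
    (p : unitInterval) (hp : 0 < p)
    {Ω : ℕ → Type*} [∀ N, MeasurableSpace (Ω N)]
    (P : ∀ N, Measure (Ω N)) [∀ N, IsProbabilityMeasure (P N)]
    (G : ∀ N, Ω N → SimpleGraph (Fin N))
    (hG : ∀ N, HasLaw (G N) (SimpleGraph.binomialRandom (Fin N) p) (P N))
    (σ : ∀ N, ℝ → Ω N → LocalDensity.Config N S)
    (hσ : ∀ N, LocalDensity.IsExactSystem p q (P N) (G N) (σ N))
    (z : ∀ N, Ω N → ℝ → Fin N → Fin S → ℝ)
    (hz : ∀ N, ∀ᵐ ω ∂(P N), LocalDensity.IsNIMFASolution p q (G N ω) (z N ω))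
    (u : ℝ → Fin S → ℝ) (hu : LocalDensity.IsMeanFieldSolution q u) :
    (LocalDensity.TendstoZeroInProbability P (fun N ω =>
        LocalDensity.dist₁ (LocalDensity.average (LocalDensity.indicators (σ N 0 ω))) (u 0)) →
      ∀ T : ℝ, 0 < T → LocalDensity.TendstoZeroInProbability P (fun N ω =>
        ⨆ t ∈ Set.Icc (0 : ℝ) T,
          LocalDensity.dist₁ (LocalDensity.average (LocalDensity.indicators (σ N t ω))) (u t))) ∧
    (LocalDensity.TendstoZeroInProbability P (fun N ω =>
        LocalDensity.dist₁ (LocalDensity.average (z N ω 0)) (u 0)) →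
      ∀ T : ℝ, 0 < T → LocalDensity.TendstoZeroInProbability P (fun N ω =>
        ⨆ t ∈ Set.Icc (0 : ℝ) T,
          LocalDensity.dist₁ (LocalDensity.average (z N ω t)) (u t))) := by
  exact ⟨fun h0 T hT =>
      LocalDensity.tendstoZeroInProbability_exact hq_lip hq_nonneg hp hG hσ hu h0 hT,
    fun h0 T _ => LocalDensity.tendstoZeroInProbability_nimfa hq_lip hq_nonneg hp hG hz hu h0 T⟩
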